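/- **Setting.** Let $d,T\ge 1$, $1\le\tau\le T$, $1\le k\le\min(d,T)$ and $1\le n\le dT$ be integers. Let $\Lambda$ be a known $\tau\times T$ matrix with complex entries, $\mathfrak m_\Lambda:=\sup_{\ell,t}|\Lambda_{\ell,t}|$, and let $\mathfrak m_\Lambda(\tau)\ge 1$ be a finite number with $\sup_{j,t}|(\mathbf T\Lambda)_{j,t}|\le\mathfrak m_\Lambda(\tau)\sup_{j,\ell}|\mathbf T_{j,\ell}|$ for every real $d\times\tau$ matrix $\mathbf T$. Let $\mathbf T^0$ be a real $d\times\tau$ matrix with $\sup_{j,\ell}|\mathbf T^0_{j,\ell}|\le\mathfrak m_0/\mathfrak m_\Lambda(\tau)$, where $\mathfrak m_0>0$, and put $\Theta^0=\mathbf T^0\Lambda$. One observes $(\mathbf X_i,Y_i)_{1\le i\le n}$ with $$Y_i=\langle \mathbf X_i,\Theta^0+\varepsilon\rangle_{\mathcal F}+\xi_i,\qquad \langle \mathbf A,\mathbf B\rangle_{\mathcal F}=\mathrm{trace}(\mathbf A^*\mathbf B),$$ where: $\mathbf X_1,\dots,\mathbf X_n$ are i.i.d. with a law $\Pi$ on the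 set of the matrices $e_je_t^*$ ($1\le j\le d$, $1\le t\le T$; one entry equal to 1, all others 0); $\xi_1,\dots,\xi_n$ are i.i.d. centered real random variables; $\mathbf X_i$ and $\xi_i$ are independent for each $i$, and the pairs $(\mathbf X_i,\xi_i)$ are mutually independent; $\varepsilon$ is a real random $d\times T$ matrix with centered entries, independent of the family $(\mathbf X_i,\xi_i)_{i\le n}$. Put $\|\mathbf A\|_{\mathcal F,\Pi}^2=\int|\langle X,\mathbf A\rangle_{\mathcal F}|^2\,\Pi(dX)$ and $r_n(\mathbf A)=\frac1n\sum_{i=1}^n|Y_i-\langle\mathbf X_i,\mathbf A\rangle_{\mathcal F}|^2$. **Assumption 1 ($\phi$-mixing).** The rows of $\varepsilon$ are i.i.d., and there is a real process $(\varepsilon_t)_{t\in\mathbb Z}$ such that each row is distributed as $(\varepsilon_1,\dots,\varepsilon_T)$. Put $\Phi_\varepsilon:=1+\sum_{i=1}^n\phi_\varepsilon(i)^{1/2}$, where $\phi_\varepsilon(i)$ is the supremum of $|\mathbb P(B)-\mathbb P(B\mid A)|$ over $t\in\mathbb Z$, $A\in\sigma(\varepsilon_h,h\le t)$ with $\mathbb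 P(A)\ne0$, and $B\in\sigma(\varepsilon_l,l\ge t+i)$. **Assumption 2.** There are $\mathfrak m_\varepsilon,\mathfrak v_\xi,\mathfrak c_\xi>0$ such that $\sup_{j,t}|\varepsilon_{j,t}|\le\mathfrak m_\varepsilon$ almost surely, $\mathbb E(\xi_i^2)\le\mathfrak v_\xi$ and $\mathbb E(|\xi_i|^q)\le\mathfrak v_\xi\mathfrak c_\xi^{q-2}q!/2$ for all $i$ and all integers $q\ge3$. **Assumption 3.** There is $\mathfrak c_\Pi>0$ such that $\Pi(\{e_je_t^*\})\le\mathfrak c_\Pi/(dT)$ for all $j,t$. **Estimator.** Let $\mathcal S_{k,\tau}$ be a set of matrices of the form $\mathbf U\mathbf V$, with $\mathbf U$ real $d\times k$ and $\mathbf V$ real $k\times\tau$, all of whose entries have absolute value at most $\sqrt{\mathfrak m_0/(k\,\mathfrak m_\Lambda(\tau))}$. Let $\widehat{\mathbf T}_{k,\tau}\in\arg\min_{\mathbf T\in\mathcal S_{k,\tau}}r_n(\mathbf T\Lambda)$ and $\widehat\Theta_{k,\tau}=\widehat{\mathbf T}_{k,\tau}\Lambda$. **Theorem.** There is a constant $\mathfrak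 c$, depending only on $\mathfrak m_0,\mathfrak v_\xi,\mathfrak c_\xi,\mathfrak m_\varepsilon,\mathfrak m_\Lambda,\Phi_\varepsilon$ and $\mathfrak c_\Pi$, such that for every $\alpha\in(0,1)$, in the setting above and under Assumptions 1, 2 and 3, if $n\ge\max(d,\tau)$, then with probability at least $1-\alpha$ $$\|\widehat\Theta_{k,\tau}-\Theta^0\|_{\mathcal F,\Pi}^2\le 3\inf_{\mathbf T\in\mathcal S_{k,\tau}}\|(\mathbf T-\mathbf T^0)\Lambda\|_{\mathcal F,\Pi}^2+\mathfrak c\left[k(d+\tau)\frac{\log n}{n}+\frac1n\log\frac4\alpha\right].$$ -/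

import Mathlib

open MeasureTheory ProbabilityTheory

/-- Matrices carry the product sigma-algebra of their entries. -/
instance matrixMeasurableSpace {m n α : Type*} [MeasurableSpace α] :
    MeasurableSpace (Matrix m n α) :=
  inferInstanceAs (MeasurableSpace (m → n → α))

noncomputable section

namespace LowRankSeries

/-- The largest modulus of an entry, `sup_{j,t} |A_{j,t}|`. -/
def entrySup {m n E : Type*} [Norm E] (A : Matrix m n E) : ℝ :=
  ⨆ p : m × n, ‖A p.1 p.2‖

/-- A real matrix seen as a complex matrix. -/
def toC {m n : Type*} (A : Matrix m n ℝ) : Matrix m n ℂ :=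
  A.map Complex.ofReal

/-- The Frobenius scalar product `trace (A^* B)`. -/
def frob {m n : Type*} [Fintype m] [Fintype n] (A B : Matrix m n ℂ) : ℂ :=
  (A.conjTranspose * B).trace

/-- The set of the `d × T` matrices `e_j e_t^*`, with one entry `1` and all others `0`. -/
def maskSet (d T : ℕ) : Set (Matrix (Fin d) (Fin T) ℝ) :=
  Set.range fun p : Fin d × Fin T => Matrix.single p.1 p.2 (1 : ℝ)

/-- `‖A‖²_{F,Π} = ∫ |⟨X, A⟩_F|² Π(dX)`. -/
def piNormSq {d T : ℕ} (P : Measure (Matrix (Fin d) (Fin T) ℝ))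
    (A : Matrix (Fin d) (Fin T) ℂ) : ℝ :=
  ∫ X, ‖frob (toC X) A‖ ^ 2 ∂P

/-- The observations `Y_i = trace (X_i^* M) + ξ_i`. -/
def observation {d T n : ℕ} (X : Fin n → Matrix (Fin d) (Fin T) ℝ)
    (M : Matrix (Fin d) (Fin T) ℂ) (ξ : Fin n → ℝ) (i : Fin n) : ℂ :=
  frob (toC (X i)) M + (ξ i : ℂ)

/-- The empirical least-squares risk `r_n(A) = (1/n) ∑_i |Y_i - ⟨X_i, A⟩_F|²`. -/
def empiricalRisk {d T n : ℕ} (X : Fin n → Matrix (Fin d) (Fin T) ℝ) (Y : Fin n → ℂ)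
    (A : Matrix (Fin d) (Fin T) ℂ) : ℝ :=
  1 / (n : ℝ) * ∑ i, ‖Y i - frob (toC (X i)) A‖ ^ 2

/-- The set of the products `U V`, with `U` of size `d × k` and `V` of size `k × τ`, whose
entries are all at most `√(m₀ / (k m))` in absolute value. -/
def factorSet (d k τ : ℕ) (m₀ m : ℝ) : Set (Matrix (Fin d) (Fin τ) ℝ) :=
  {A | ∃ (U : Matrix (Fin d) (Fin k) ℝ) (V : Matrix (Fin k) (Fin τ) ℝ),
    entrySup U ≤ √(m₀ / (k * m)) ∧ entrySup V ≤ √(m₀ / (k * m)) ∧ A = U * V}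

/-- The φ-mixing coefficient between two sigma-algebras: the supremum of `|P(B) - P(B | A)|`
over `A` in the first one with `P(A) ≠ 0` and `B` in the second one. -/
def phiCoeff {Ω : Type*} [MeasurableSpace Ω] (P : Measure Ω) (mA mB : MeasurableSpace Ω) : ℝ :=
  sSup {x | ∃ A B : Set Ω, MeasurableSet[mA] A ∧ MeasurableSet[mB] B ∧ P A ≠ 0 ∧
    x = |P.real B - (cond P A).real B|}

/-- The φ-mixing coefficients of a process indexed by `ℤ`: the supremum over `t` of the
coefficient between `σ(Z_h, h ≤ t)` and `σ(Z_l, l ≥ t + i)`. -/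
def phiMixing {Ω : Type*} [MeasurableSpace Ω] (P : Measure Ω) (Z : ℤ → Ω → ℝ) (i : ℕ) : ℝ :=
  ⨆ t : ℤ, phiCoeff P
    (⨆ h : {h : ℤ // h ≤ t}, MeasurableSpace.comap (Z h) inferInstance)
    (⨆ l : {l : ℤ // t + (i : ℤ) ≤ l}, MeasurableSpace.comap (Z l) inferInstance)

/-- `Φ = 1 + ∑_{i=1}^n φ_Z(i)^{1/2}`. -/
def mixingSum {Ω : Type*} [MeasurableSpace Ω] (P : Measure Ω) (Z : ℤ → Ω → ℝ) (n : ℕ) : ℝ :=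
  1 + ∑ i ∈ Finset.Icc 1 n, √(phiMixing P Z i)

/-- The random elements of the sampling model: i.i.d. masks `X_i` with law `P` on `maskSet`,
i.i.d. centered observation errors `ξ_i`, with `X_i` independent of `ξ_i` and the pairs
`(X_i, ξ_i)` mutually independent, and a centered random noise matrix `ε` with i.i.d. rows,
independent of all the `(X_i, ξ_i)`. -/
structure SamplingModel {Ω : Type*} [MeasurableSpace Ω] (μ : Measure Ω) {d T n : ℕ}
    (P : Measure (Matrix (Fin d) (Fin T) ℝ))
    (X : Fin n → Ω → Matrix (Fin d) (Fin T) ℝ) (ξ : Fin n → Ω → ℝ)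
    (ε : Ω → Matrix (Fin d) (Fin T) ℝ) : Prop where
  measurable_X : ∀ i, Measurable (X i)
  measurable_ξ : ∀ i, Measurable (ξ i)
  measurable_ε : Measurable ε
  mem_maskSet : ∀ i ω, X i ω ∈ maskSet d T
  law_X : ∀ i, μ.map (X i) = P
  identDistrib_ξ : ∀ i i', IdentDistrib (ξ i) (ξ i') μ μ
  indep_pairs : iIndepFun (fun i ω => (X i ω, ξ i ω)) μ
  indep_X_ξ : ∀ i, IndepFun (X i) (ξ i) μ
  indep_ε : IndepFun (fun ω i => (X i ω, ξ i ω)) ε μ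
  integrable_ξ : ∀ i, Integrable (ξ i) μ
  centered_ξ : ∀ i, ∫ ω, ξ i ω ∂μ = 0
  integrable_ε : ∀ j t, Integrable (fun ω => ε ω j t) μ
  centered_ε : ∀ j t, ∫ ω, ε ω j t ∂μ = 0
  iid_rows_indep : iIndepFun (fun j ω => ε ω j) μ
  iid_rows_ident : ∀ j j', IdentDistrib (fun ω => ε ω j) (fun ω => ε ω j') μ μ

/-- Every row of `ε` is distributed as `(Z_1, …, Z_T)`, for a process `(Z_t)_{t ∈ ℤ}`. -/
def RowsFromProcess {Ω Ω' : Type*} [MeasurableSpace Ω] [MeasurableSpace Ω'] (μ : Measure Ω)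
    (ν : Measure Ω') {d T : ℕ} (ε : Ω → Matrix (Fin d) (Fin T) ℝ) (Z : ℤ → Ω' → ℝ) : Prop :=
  (∀ t, Measurable (Z t)) ∧
    ∀ j, IdentDistrib (fun ω => ε ω j) (fun ω' (t : Fin T) => Z ((t : ℤ) + 1) ω') μ ν

/-- Bounded noise matrix and sub-exponential observation errors. -/
structure NoiseBounds {Ω : Type*} [MeasurableSpace Ω] (μ : Measure Ω) {d T n : ℕ}
    (ξ : Fin n → Ω → ℝ) (ε : Ω → Matrix (Fin d) (Fin T) ℝ) (mε vξ cξ : ℝ) : Prop where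
  bound_ε : ∀ᵐ ω ∂μ, ∀ j t, |ε ω j t| ≤ mε
  integrable_moments : ∀ i, ∀ q : ℕ, Integrable (fun ω => |ξ i ω| ^ q) μ
  second_moment : ∀ i, ∫ ω, ξ i ω ^ 2 ∂μ ≤ vξ
  higher_moments : ∀ i, ∀ q : ℕ, 3 ≤ q →
    ∫ ω, |ξ i ω| ^ q ∂μ ≤ vξ * cξ ^ (q - 2) * (q.factorial : ℝ) / 2

end LowRankSeries

end

/-!
Write `D = (T - T⁰)Λ` for a candidate `T` and let `J_i` be the position of the entry that the mask
`X_i` selects. Up to a term that does not depend on `T`, the empirical risk is the average of the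
excess losses `|D_{J_i}|² - 2 (ε_{J_i} + ξ_i) Re D_{J_i}`, whose mean is `‖D‖²_{F,Π}`. The theorem
follows if, uniformly over the candidates, this average deviates from its mean by at most a
fraction of the mean plus the rate.

For one candidate this is a Bernstein argument (`lintegral_exp_sum_excessLoss_le`). For a fixed
noise matrix the pairs `(J_i, ξ_i)` are independent and the exponential moment of a summand has a
quadratic term proportional to `‖D‖²_{F,Π}` (`integral_exp_excessLoss_le`). The fixed noise leaves
the linear form `n ∑ Π_{jt} ε_{jt} Re D_{jt}`, which is centered only after integration over `ε`.
Its exponential moment is the product of those of the rows, each bounded by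
`integral_exp_weighted_sum_le`: the conditional expectations of `Z_t` given the past up to
`t - i`, for `i ≤ n`, split a row into `n` martingale sums, to which Azuma's inequality applies with
increments bounded by the φ-mixing coefficients, and a remainder of order `φ(n) ≤ Φ / n`. Hence
nothing is lost when the length `T` of the rows is much larger than `n`. As `Π_{jt} ≤ c_Π / (dT)`
and `n ≤ dT`, the resulting variance is again at most a multiple of `‖D‖²_{F,Π} / n`.

The products of factors with entries on a grid, of step `1 / n` times their bound, approximate all
candidates (`exists_grid_approx`), and the logarithm of their number is of order
`k (d + τ) log n`. A union bound over this family, one further deviation bound at an almost optimal element of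
`S`, and a bound on `∑ |ξ_i|`, which pays for the approximation, give the oracle inequality
(`exists_event_oracle`).
-/

namespace LowRankSeries

/-! ### The φ-mixing coefficients -/

section Mixing

variable {Ω : Type*}

theorem abs_real_sub_cond_real_le_one [mΩ : MeasurableSpace Ω] {P : Measure Ω}
    [IsProbabilityMeasure P] (A B : Set Ω) :
    |P.real B - (cond P A).real B| ≤ 1 := by
  have h1 : P.real B ≤ 1 := measureReal_le_one
  have h2 : (cond P A).real B ≤ 1 := measureReal_le_one
  have h3 : 0 ≤ P.real B := measureReal_nonneg
  have h4 : 0 ≤ (cond P A).real B := measureReal_nonneg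
  rw [abs_le]
  constructor <;> linarith

theorem abs_real_sub_cond_real_le_phiCoeff {mA mB : MeasurableSpace Ω}
    [mΩ : MeasurableSpace Ω] {P : Measure Ω} [IsProbabilityMeasure P] {A B : Set Ω}
    (hA : MeasurableSet[mA] A) (hB : MeasurableSet[mB] B) (h0 : P A ≠ 0) :
    |P.real B - (cond P A).real B| ≤ phiCoeff P mA mB := by
  refine le_csSup ⟨1, ?_⟩ ⟨A, B, hA, hB, h0, rfl⟩
  rintro x ⟨A, B, -, -, -, rfl⟩
  exact abs_real_sub_cond_real_le_one A B

theorem phiCoeff_nonneg (mA mB : MeasurableSpace Ω)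
    [mΩ : MeasurableSpace Ω] {P : Measure Ω} [IsProbabilityMeasure P] : 0 ≤ phiCoeff P mA mB := by
  apply Real.sSup_nonneg
  rintro x ⟨A, B, -, -, -, rfl⟩
  positivity

theorem phiCoeff_le_one (mA mB : MeasurableSpace Ω)
    [mΩ : MeasurableSpace Ω] {P : Measure Ω} [IsProbabilityMeasure P] : phiCoeff P mA mB ≤ 1 := by
  apply Real.sSup_le _ zero_le_one
  rintro x ⟨A, B, -, -, -, rfl⟩
  exact abs_real_sub_cond_real_le_one A B

theorem phiCoeff_mono_right (mA : MeasurableSpace Ω) {mB mB' : MeasurableSpace Ω}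
    [mΩ : MeasurableSpace Ω] {P : Measure Ω} [IsProbabilityMeasure P] (h : mB ≤ mB') :
    phiCoeff P mA mB ≤ phiCoeff P mA mB' := by
  apply Real.sSup_le _ (phiCoeff_nonneg _ _)
  rintro x ⟨A, B, hA, hB, h0, rfl⟩
  exact abs_real_sub_cond_real_le_phiCoeff hA (h _ hB) h0

/-- The sigma-algebra `σ(Z_h, h ≤ t)` of the past of a process up to time `t`. -/
abbrev pastSigma (Z : ℤ → Ω → ℝ) (t : ℤ) : MeasurableSpace Ω :=
  ⨆ h : {h : ℤ // h ≤ t}, MeasurableSpace.comap (Z h) inferInstance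

/-- The sigma-algebra `σ(Z_l, l ≥ t)` of the future of a process from time `t` on. -/
abbrev futureSigma (Z : ℤ → Ω → ℝ) (t : ℤ) : MeasurableSpace Ω :=
  ⨆ l : {l : ℤ // t ≤ l}, MeasurableSpace.comap (Z l) inferInstance

theorem phiMixing_eq [MeasurableSpace Ω] {P : Measure Ω}
    (Z : ℤ → Ω → ℝ) (i : ℕ) :
    phiMixing P Z i = ⨆ t : ℤ, phiCoeff P (pastSigma Z t) (futureSigma Z (t + i)) := rfl

theorem phiCoeff_le_phiMixing [mΩ : MeasurableSpace Ω] {P : Measure Ω} [IsProbabilityMeasure P]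
    (Z : ℤ → Ω → ℝ) (i : ℕ) (t : ℤ) :
    phiCoeff P (pastSigma Z t) (futureSigma Z (t + i)) ≤ phiMixing P Z i := by
  rw [phiMixing_eq]
  refine le_ciSup (f := fun t : ℤ => phiCoeff P (pastSigma Z t) (futureSigma Z (t + i))) ⟨1, ?_⟩ t
  rintro x ⟨t, rfl⟩
  exact phiCoeff_le_one _ _

theorem phiMixing_nonneg [mΩ : MeasurableSpace Ω] {P : Measure Ω} [IsProbabilityMeasure P]
    (Z : ℤ → Ω → ℝ) (i : ℕ) : 0 ≤ phiMixing P Z i :=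
  (phiCoeff_nonneg _ _).trans (phiCoeff_le_phiMixing Z i 0)

theorem phiMixing_le_one [mΩ : MeasurableSpace Ω] {P : Measure Ω} [IsProbabilityMeasure P]
    (Z : ℤ → Ω → ℝ) (i : ℕ) : phiMixing P Z i ≤ 1 :=
  ciSup_le fun _ => phiCoeff_le_one _ _

theorem phiMixing_antitone [mΩ : MeasurableSpace Ω] {P : Measure Ω} [IsProbabilityMeasure P]
    (Z : ℤ → Ω → ℝ) : Antitone (phiMixing P Z) := by
  intro i i' h
  rw [phiMixing_eq]
  refine ciSup_le fun t => (phiCoeff_mono_right _ ?_).trans (phiCoeff_le_phiMixing Z i t)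
  refine iSup_le fun l => ?_
  exact le_iSup (fun l : {l : ℤ // t + (i : ℤ) ≤ l} =>
    MeasurableSpace.comap (Z l) inferInstance) ⟨l, by have := l.2; omega⟩

theorem one_le_mixingSum [MeasurableSpace Ω] {P : Measure Ω}
    (Z : ℤ → Ω → ℝ) (n : ℕ) : 1 ≤ mixingSum P Z n := by
  have : 0 ≤ ∑ i ∈ Finset.Icc 1 n, √(phiMixing P Z i) :=
    Finset.sum_nonneg fun _ _ => Real.sqrt_nonneg _
  unfold mixingSum
  linarith

theorem phiMixing_le_sqrt [mΩ : MeasurableSpace Ω] {P : Measure Ω} [IsProbabilityMeasure P]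
    (Z : ℤ → Ω → ℝ) (i : ℕ) : phiMixing P Z i ≤ √(phiMixing P Z i) :=
  Real.le_sqrt_of_sq_le (by
    nlinarith [phiMixing_nonneg (P := P) Z i, phiMixing_le_one (P := P) Z i])

/-- The coefficients are nonincreasing, so the last one is at most the average of the `n` terms
of the mixing sum. -/
theorem phiMixing_le_mixingSum_div [mΩ : MeasurableSpace Ω] {P : Measure Ω} [IsProbabilityMeasure P]
    (Z : ℤ → Ω → ℝ) {n : ℕ} (hn : 1 ≤ n) :
    phiMixing P Z n ≤ mixingSum P Z n / n := by
  refine (phiMixing_le_sqrt Z n).trans ?_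
  have hn' : (0 : ℝ) < n := by exact_mod_cast hn
  rw [le_div_iff₀ hn']
  have h : ∑ i ∈ Finset.Icc 1 n, √(phiMixing P Z n) ≤ ∑ i ∈ Finset.Icc 1 n, √(phiMixing P Z i) :=
    Finset.sum_le_sum fun i hi =>
      Real.sqrt_le_sqrt (phiMixing_antitone Z (Finset.mem_Icc.1 hi).2)
  simp only [Finset.sum_const, Nat.card_Icc, add_tsub_cancel_right, nsmul_eq_mul] at h
  unfold mixingSum
  linarith

theorem pastSigma_mono (Z : ℤ → Ω → ℝ) : Monotone (pastSigma Z) := by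
  intro s t hst
  refine iSup_le fun h => ?_
  exact le_iSup (fun h : {h : ℤ // h ≤ t} =>
    MeasurableSpace.comap (Z h) inferInstance) ⟨h, h.2.trans hst⟩

theorem pastSigma_le [mΩ : MeasurableSpace Ω] {Z : ℤ → Ω → ℝ} (hZ : ∀ t, Measurable (Z t)) (t : ℤ) :
    pastSigma Z t ≤ mΩ :=
  iSup_le fun h => (hZ h).comap_le

theorem measurable_pastSigma (Z : ℤ → Ω → ℝ) {s t : ℤ} (h : s ≤ t) :
    Measurable[pastSigma Z t] (Z s) :=
  Measurable.of_comap_le (le_iSup (fun h : {h : ℤ // h ≤ t} =>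
    MeasurableSpace.comap (Z h) inferInstance) ⟨s, h⟩)

theorem measurable_futureSigma (Z : ℤ → Ω → ℝ) {s t : ℤ} (h : t ≤ s) :
    Measurable[futureSigma Z t] (Z s) :=
  Measurable.of_comap_le (le_iSup (fun l : {l : ℤ // t ≤ l} =>
    MeasurableSpace.comap (Z l) inferInstance) ⟨s, h⟩)

/-- The integral of a bounded centered variable over an event is controlled by the φ-mixing
coefficient; by the layer-cake formula, it is enough to compare the measures of level sets. -/
theorem abs_setIntegral_le_phiCoeff {mA mB : MeasurableSpace Ω}
    [mΩ : MeasurableSpace Ω] {P : Measure Ω} [IsProbabilityMeasure P]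
    (hmA : mA ≤ mΩ) (hmB : mB ≤ mΩ)
    {V : Ω → ℝ} (hV : Measurable[mB] V) {m : ℝ} (hm : 0 ≤ m) (hb : ∀ᵐ ω ∂P, |V ω| ≤ m)
    (h0 : ∫ ω, V ω ∂P = 0) {A : Set Ω} (hA : MeasurableSet[mA] A) :
    |∫ ω in A, V ω ∂P| ≤ 2 * m * phiCoeff P mA mB * P.real A := by
  have hVm : Measurable V := hV.mono hmB le_rfl
  have hVi : Integrable V P :=
    Integrable.of_bound hVm.aestronglyMeasurable m (by simpa [Real.norm_eq_abs] using hb)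
  by_cases hPA : P A = 0
  · have : P.restrict A = 0 := Measure.restrict_eq_zero.2 hPA
    simp [this, Measure.real, hPA]
  have hA' : MeasurableSet A := hmA _ hA
  set f : Ω → ℝ := fun ω => V ω + m with hf
  have hfi : Integrable f P := hVi.add (integrable_const _)
  have hf0 : ∀ᵐ ω ∂P, 0 ≤ f ω := by
    filter_upwards [hb] with ω h
    have := (abs_le.1 h).1
    simp only [hf]; linarith
  have hf1 : ∀ᵐ ω ∂P, f ω ≤ 2 * m := by
    filter_upwards [hb] with ω h
    have := (abs_le.1 h).2
    simp only [hf]; linarith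
  have e1 := hfi.integral_eq_integral_Ioc_meas_le hf0 hf1
  have e2 := hfi.restrict (s := A) |>.integral_eq_integral_Ioc_meas_le
    (ae_restrict_of_ae hf0) (ae_restrict_of_ae hf1)
  have e3 : ∫ ω, f ω ∂P = m := by
    simp only [hf]
    rw [integral_add hVi (integrable_const _), h0]; simp
  have e4 : ∫ ω in A, f ω ∂P = (∫ ω in A, V ω ∂P) + P.real A * m := by
    simp only [hf]
    rw [integral_add hVi.restrict (integrable_const _)]; simp
  have hanti : ∀ Q : Measure Ω, IsFiniteMeasure Q →
      IntegrableOn (fun u : ℝ => Q.real {a | u ≤ f a}) (Set.Ioc 0 (2 * m)) := by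
    intro Q _
    have hQ : Antitone fun u : ℝ => Q.real {a | u ≤ f a} := fun u v huv =>
      measureReal_mono (fun a (ha : v ≤ f a) => huv.trans ha)
    exact ((hQ.antitoneOn _).integrableOn_isCompact isCompact_Icc).mono_set Set.Ioc_subset_Icc_self
  have e5 : ∫ ω in A, V ω ∂P = ∫ u in Set.Ioc 0 (2 * m),
      ((P.restrict A).real {a | u ≤ f a} - P.real A * P.real {a | u ≤ f a}) := by
    rw [integral_sub (hanti _ inferInstance) ((hanti _ inferInstance).const_mul _),
      integral_const_mul, ← e1, ← e2, e3, e4]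
    ring
  have hbound : ∀ u ∈ Set.Ioc 0 (2 * m), ‖(P.restrict A).real {a | u ≤ f a} -
      P.real A * P.real {a | u ≤ f a}‖ ≤ P.real A * phiCoeff P mA mB := by
    intro u _
    have hB : MeasurableSet[mB] {a | u ≤ f a} :=
      measurableSet_Ici.preimage (hV.add_const m)
    have h := abs_real_sub_cond_real_le_phiCoeff (P := P) hA hB hPA
    have hPA' : 0 < P.real A := (measureReal_nonneg).lt_of_ne' (by
      simpa [Measure.real, ENNReal.toReal_eq_zero_iff] using hPA)
    have hc : (P.restrict A).real {a | u ≤ f a} = P.real A * (cond P A).real {a | u ≤ f a} := by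
      rw [Measure.real, Measure.real, Measure.real, cond_apply hA', ENNReal.toReal_mul,
        ENNReal.toReal_inv, Measure.restrict_apply (hmB _ hB), Set.inter_comm]
      exact (mul_inv_cancel_left₀ hPA'.ne' _).symm
    rw [hc, ← mul_sub, Real.norm_eq_abs, abs_mul, abs_of_pos hPA', abs_sub_comm]
    gcongr
  rw [e5, ← Real.norm_eq_abs]
  refine (norm_setIntegral_le_of_norm_le_const (by simp [ENNReal.mul_lt_top]) hbound).trans
    (le_of_eq ?_)
  simp [Measure.real, ENNReal.toReal_ofReal, hm]
  ring

/-- A bounded centered variable has a small conditional expectation given a sigma-algebra from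
which it is almost independent in the sense of φ-mixing. -/
theorem abs_condExp_le_phiCoeff {mA mB : MeasurableSpace Ω}
    [mΩ : MeasurableSpace Ω] {P : Measure Ω} [IsProbabilityMeasure P]
    (hmA : mA ≤ mΩ) (hmB : mB ≤ mΩ)
    {V : Ω → ℝ} (hV : Measurable[mB] V) {m : ℝ} (hm : 0 ≤ m) (hb : ∀ᵐ ω ∂P, |V ω| ≤ m)
    (h0 : ∫ ω, V ω ∂P = 0) :
    ∀ᵐ ω ∂P, |(P[V|mA]) ω| ≤ 2 * m * phiCoeff P mA mB := by
  have hVm : Measurable V := hV.mono hmB le_rfl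
  have hVi : Integrable V P :=
    Integrable.of_bound hVm.aestronglyMeasurable m (by simpa [Real.norm_eq_abs] using hb)
  have hg : Integrable (P[V|mA]) (P.trim hmA) :=
    integrable_condExp.trim hmA stronglyMeasurable_condExp
  have key : ∀ A, MeasurableSet[mA] A →
      |∫ ω in A, (P[V|mA]) ω ∂(P.trim hmA)| ≤ 2 * m * phiCoeff P mA mB * (P.trim hmA).real A := by
    intro A hA
    rw [← setIntegral_trim hmA stronglyMeasurable_condExp hA, setIntegral_condExp hmA hVi hA,
      Measure.real, trim_measurableSet_eq hmA hA]
    exact abs_setIntegral_le_phiCoeff hmA hmB hV hm hb h0 hA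
  have h1 : ∀ᵐ ω ∂(P.trim hmA), (P[V|mA]) ω ≤ 2 * m * phiCoeff P mA mB := by
    refine ae_le_of_forall_setIntegral_le hg (integrable_const _) fun s hs _ => ?_
    have := (abs_le.1 (key s hs)).2
    simp only [setIntegral_const, smul_eq_mul]
    linarith
  have h2 : ∀ᵐ ω ∂(P.trim hmA), -(2 * m * phiCoeff P mA mB) ≤ (P[V|mA]) ω := by
    refine ae_le_of_forall_setIntegral_le (integrable_const _) hg fun s hs _ => ?_
    have := (abs_le.1 (key s hs)).1
    simp only [setIntegral_const, smul_eq_mul]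
    linarith
  filter_upwards [ae_of_ae_trim hmA h1, ae_of_ae_trim hmA h2] with ω h h'
  exact abs_le.2 ⟨h', h⟩

end Mixing

/-! ### Exponential moments of weighted sums of a φ-mixing process -/

/-- The Azuma–Hoeffding bound on the exponential moment of a sum of bounded martingale
differences. -/
theorem integral_exp_sum_le_of_martingaleDiff {Ω : Type*} [mΩ : MeasurableSpace Ω]
    {P : Measure Ω} [IsProbabilityMeasure P] {G : ℕ → MeasurableSpace Ω} (hG : Monotone G)
    (hle : ∀ j, G j ≤ mΩ) {D : ℕ → Ω → ℝ} {c : ℕ → ℝ} (N : ℕ)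
    (hD : ∀ j < N, StronglyMeasurable[G (j + 1)] (D j))
    (hb : ∀ j < N, ∀ᵐ ω ∂P, |D j ω| ≤ c j) (h0 : ∀ j < N, P[D j|G j] =ᵐ[P] 0) :
    Integrable (fun ω => Real.exp (∑ j ∈ Finset.range N, D j ω)) P ∧
      ∫ ω, Real.exp (∑ j ∈ Finset.range N, D j ω) ∂P ≤
        Real.exp (∑ j ∈ Finset.range N, c j ^ 2 / 2) := by
  induction N with
  | zero => simp
  | succ N ih =>
    obtain ⟨ih1, ih2⟩ := ih (fun j hj => hD j (by omega)) (fun j hj => hb j (by omega))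
      (fun j hj => h0 j (by omega))
    set F : Ω → ℝ := fun ω => Real.exp (∑ j ∈ Finset.range N, D j ω) with hF
    have hFm : StronglyMeasurable[G N] F := by
      refine Real.continuous_exp.comp_stronglyMeasurable ?_
      refine Finset.stronglyMeasurable_fun_sum _ fun j hj => ?_
      have hj' := Finset.mem_range.1 hj
      exact (hD j (by omega)).mono (hG (by omega))
    have hbN := hb N (by omega)
    have hDN : AEStronglyMeasurable (D N) P :=
      ((hD N (by omega)).mono (hle _)).aestronglyMeasurable
    have hDi : Integrable (D N) P :=
      Integrable.of_bound hDN (c N) (by simpa [Real.norm_eq_abs] using hbN)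
    have hFD : Integrable (fun ω => F ω * D N ω) P := by
      refine (ih1.mul_bdd (c := c N) hDN ?_)
      simpa [Real.norm_eq_abs] using hbN
    have hzero : ∫ ω, F ω * D N ω ∂P = 0 := by
      have h1 : P[F * D N|G N] =ᵐ[P] F * P[D N|G N] :=
        condExp_mul_of_stronglyMeasurable_left hFm hFD hDi
      have h2 : P[F * D N|G N] =ᵐ[P] 0 := by
        filter_upwards [h1, h0 N (by omega)] with ω h h'
        simp [h, h']
      have h3 := integral_condExp (μ := P) (f := F * D N) (hle N)
      rw [integral_congr_ae h2] at h3
      simpa using h3.symm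
    -- the convexity of `exp` on `[-c, c]`
    have hpt : ∀ᵐ ω ∂P, F ω * Real.exp (D N ω) ≤
        Real.cosh (c N) * F ω + Real.sinh (c N) / c N * (F ω * D N ω) := by
      filter_upwards [hbN] with ω h
      have hFp : 0 ≤ F ω := (Real.exp_pos _).le
      have key : Real.exp (D N ω) ≤ Real.cosh (c N) + D N ω / c N * Real.sinh (c N) := by
        rcases ((abs_nonneg _).trans h).eq_or_lt with hc | hc
        · rw [← hc, abs_nonpos_iff] at h
          simp [← hc, h]
        · have := Real.exp_mul_le_cosh_add_mul_sinh (t := D N ω / c N)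
            (by rw [abs_div, abs_of_pos hc, div_le_one hc]; exact h) (c N)
          rwa [div_mul_cancel₀ _ hc.ne'] at this
      calc F ω * Real.exp (D N ω)
          ≤ F ω * (Real.cosh (c N) + D N ω / c N * Real.sinh (c N)) := by gcongr
        _ = _ := by ring
    have hR : Integrable (fun ω =>
        Real.cosh (c N) * F ω + Real.sinh (c N) / c N * (F ω * D N ω)) P :=
      (ih1.const_mul _).add (hFD.const_mul _)
    have hL : Integrable (fun ω => F ω * Real.exp (D N ω)) P := by
      refine hR.mono' (ih1.aestronglyMeasurable.mul
        (Real.continuous_exp.comp_aestronglyMeasurable hDN)) ?_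
      filter_upwards [hpt] with ω h
      rwa [Real.norm_of_nonneg (by positivity)]
    have hsum : ∀ ω, Real.exp (∑ j ∈ Finset.range (N + 1), D j ω) = F ω * Real.exp (D N ω) :=
      fun ω => by rw [Finset.sum_range_succ, Real.exp_add]
    simp only [hsum]
    refine ⟨hL, (integral_mono_ae hL hR hpt).trans ?_⟩
    rw [integral_add (ih1.const_mul _) (hFD.const_mul _), integral_const_mul, integral_const_mul,
      hzero, mul_zero, add_zero, Finset.sum_range_succ, Real.exp_add, mul_comm]
    gcongr
    exact Real.cosh_le_exp_half_sq _

/-- The exponential moment of a weighted sum of a bounded centered φ-mixing process.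
With `M_i(t) = E[Z_t | Z_h, h ≤ t - i]`, the sum is split into the martingale sums
`∑_t w_t (M_i(t) - M_{i+1}(t))` for `i < n`, which are bounded by Azuma's inequality and recombined
by the convexity of the exponential, and the remainder `∑_t w_t M_n(t)`, which is small almost
surely because of the mixing. The length `T` of the sum may exceed the number `n` of mixing
coefficients that `mixingSum` takes into account. -/
theorem integral_exp_weighted_sum_le {Ω : Type*} [mΩ : MeasurableSpace Ω]
    {P : Measure Ω} [IsProbabilityMeasure P] {Z : ℤ → Ω → ℝ} (hZ : ∀ t, Measurable (Z t))
    {T n : ℕ} (hn : 1 ≤ n) {m : ℝ} (hm : 0 < m)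
    (hb : ∀ t : ℕ, t < T → ∀ᵐ ω ∂P, |Z ((t : ℤ) + 1) ω| ≤ m)
    (h0 : ∀ t : ℕ, t < T → ∫ ω, Z ((t : ℤ) + 1) ω ∂P = 0) (w : ℕ → ℝ) :
    Integrable (fun ω => Real.exp (∑ t ∈ Finset.range T, w t * Z ((t : ℤ) + 1) ω)) P ∧
    ∫ ω, Real.exp (∑ t ∈ Finset.range T, w t * Z ((t : ℤ) + 1) ω) ∂P ≤
      Real.exp ((5 * m * mixingSum P Z n) ^ 2 / 2 * ∑ t ∈ Finset.range T, w t ^ 2 +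
        2 * m * (mixingSum P Z n / n) * ∑ t ∈ Finset.range T, |w t|) := by
  have hn' : (0 : ℝ) < n := by exact_mod_cast hn
  set Φ := mixingSum P Z n with hΦ
  set M : ℤ → ℕ → Ω → ℝ := fun s t => P[Z ((t : ℤ) + 1)|pastSigma Z s] with hM
  set ψ : ℕ → ℝ := fun i => if i = 0 then 1 else √(phiMixing P Z i) with hψ
  have hψ0 : ∀ i, 0 ≤ ψ i := fun i => by
    simp only [hψ]; split_ifs
    · exact zero_le_one
    · exact Real.sqrt_nonneg _
  have hZi : ∀ t < T, Integrable (Z ((t : ℤ) + 1)) P := fun t ht =>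
    Integrable.of_bound (hZ _).aestronglyMeasurable m
      (by simpa [Real.norm_eq_abs] using hb t ht)
  -- `M` at lag zero is the process itself
  have hM0 : ∀ t < T, M ((t : ℤ) + 1) t = Z ((t : ℤ) + 1) := fun t ht =>
    condExp_of_stronglyMeasurable (pastSigma_le hZ _)
      (measurable_pastSigma Z le_rfl).stronglyMeasurable (hZi t ht)
  have hMφ : ∀ t < T, ∀ i : ℕ, ∀ᵐ ω ∂P,
      |M ((t : ℤ) + 1 - i) t ω| ≤ 2 * m * phiMixing P Z i := by
    intro t ht i
    have h := abs_condExp_le_phiCoeff (pastSigma_le hZ ((t : ℤ) + 1 - i))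
      (mB := futureSigma Z ((t : ℤ) + 1 - i + i))
      (iSup_le fun l => (hZ l).comap_le) (measurable_futureSigma Z (s := (t : ℤ) + 1) (by omega))
      hm.le (hb t ht) (h0 t ht)
    filter_upwards [h] with ω h
    refine h.trans ?_
    gcongr
    exact phiCoeff_le_phiMixing Z i _
  have hMψ : ∀ t < T, ∀ i : ℕ, ∀ᵐ ω ∂P, |M ((t : ℤ) + 1 - i) t ω| ≤ 2 * m * ψ i := by
    intro t ht i
    by_cases hi : i = 0
    · subst hi
      filter_upwards [hb t ht] with ω h
      simp only [hψ, Nat.cast_zero, sub_zero, hM0 t ht, if_true]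
      linarith
    · filter_upwards [hMφ t ht i] with ω h
      refine h.trans ?_
      simp only [hψ, if_neg hi]
      gcongr
      exact phiMixing_le_sqrt Z i
  -- the positive summand `m / n` allows the division by `b i`
  set b : ℕ → ℝ := fun i => 2 * m * (ψ i + ψ (i + 1)) + m / n with hbdef
  have hbpos : ∀ i, 0 < b i := fun i => by
    have := hψ0 i; have := hψ0 (i + 1)
    simp only [hbdef]; positivity
  set A := ∑ i ∈ Finset.range n, b i with hA
  have hApos : 0 < A := Finset.sum_pos (fun i _ => hbpos i) ⟨0, by simp; omega⟩
  have hψsum : ∑ i ∈ Finset.range (n + 1), ψ i = Φ := by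
    rw [Finset.sum_range_succ', hΦ, mixingSum, add_comm]
    congr 1
    rw [Finset.range_eq_Ico, Finset.sum_Ico_add' (fun i => ψ i) 0 n 1]
    refine Finset.sum_congr rfl fun i hi => ?_
    have := (Finset.mem_Icc.1 hi).1
    simp only [hψ]
    rw [if_neg (by omega)]
  have hAle : A ≤ 5 * m * Φ := by
    have h1 : ∑ i ∈ Finset.range n, ψ i ≤ Φ := by
      rw [← hψsum, Finset.sum_range_succ]; linarith [hψ0 n]
    have h2 : ∑ i ∈ Finset.range n, ψ (i + 1) ≤ Φ := by
      rw [← hψsum, Finset.sum_range_succ']; linarith [hψ0 0]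
    have h3 : A = 2 * m * (∑ i ∈ Finset.range n, ψ i + ∑ i ∈ Finset.range n, ψ (i + 1)) + m := by
      simp only [hA, hbdef]
      rw [Finset.sum_add_distrib, ← Finset.mul_sum, Finset.sum_add_distrib]
      simp only [Finset.sum_const, Finset.card_range, nsmul_eq_mul]
      field_simp
    have h4 : 1 ≤ Φ := one_le_mixingSum Z n
    rw [h3]
    nlinarith
  set D : ℕ → ℕ → Ω → ℝ := fun i t ω =>
    A / b i * (w t * (M ((t : ℤ) + 1 - i) t ω - M ((t : ℤ) - i) t ω)) with hDdef
  have hAz : ∀ i : ℕ, Integrable (fun ω => Real.exp (∑ t ∈ Finset.range T, D i t ω)) P ∧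
      ∫ ω, Real.exp (∑ t ∈ Finset.range T, D i t ω) ∂P ≤
        Real.exp (∑ t ∈ Finset.range T, (A * |w t|) ^ 2 / 2) := by
    intro i
    refine integral_exp_sum_le_of_martingaleDiff (G := fun j => pastSigma Z ((j : ℤ) - i))
      (fun j j' hj => pastSigma_mono Z (by omega)) (fun j => pastSigma_le hZ _) T ?_ ?_ ?_
    · intro t ht
      refine ((StronglyMeasurable.sub ?_ ?_).const_mul (w t)).const_mul (A / b i)
      · exact stronglyMeasurable_condExp
      · exact stronglyMeasurable_condExp.mono (pastSigma_mono Z (by push_cast; omega))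
    · intro t ht
      have h2 := hMψ t ht (i + 1)
      have e : (t : ℤ) + 1 - ((i + 1 : ℕ) : ℤ) = t - i := by push_cast; ring
      rw [e] at h2
      filter_upwards [hMψ t ht i, h2] with ω h1 h2
      have h3 : |M ((t : ℤ) + 1 - i) t ω - M ((t : ℤ) - i) t ω| ≤ b i := by
        refine (abs_sub _ _).trans ?_
        have : 0 < m / n := by positivity
        simp only [hbdef]
        linarith
      simp only [hDdef]
      rw [abs_mul, abs_mul, abs_of_pos (div_pos hApos (hbpos i))]
      calc A / b i * (|w t| * |M ((t : ℤ) + 1 - i) t ω - M ((t : ℤ) - i) t ω|)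
          ≤ A / b i * (|w t| * b i) := by
            have := hbpos i
            gcongr
        _ = A * |w t| := by have := (hbpos i).ne'; field_simp
    · intro t ht
      have e1 : P[M ((t : ℤ) + 1 - i) t|pastSigma Z ((t : ℤ) - i)] =ᵐ[P] M ((t : ℤ) - i) t :=
        condExp_condExp_of_le (pastSigma_mono Z (by omega)) (pastSigma_le hZ _)
      have e2 : P[M ((t : ℤ) - i) t|pastSigma Z ((t : ℤ) - i)] = M ((t : ℤ) - i) t :=
        condExp_of_stronglyMeasurable (pastSigma_le hZ _) stronglyMeasurable_condExp
          integrable_condExp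
      have e3 := condExp_sub (μ := P) (f := M ((t : ℤ) + 1 - i) t) (g := M ((t : ℤ) - i) t)
        integrable_condExp integrable_condExp (pastSigma Z ((t : ℤ) - i))
      have e4 := condExp_smul (μ := P) (A / b i * w t)
        (M ((t : ℤ) + 1 - i) t - M ((t : ℤ) - i) t) (pastSigma Z ((t : ℤ) - i))
      have e5 : D i t = (A / b i * w t) • (M ((t : ℤ) + 1 - i) t - M ((t : ℤ) - i) t) := by
        ext ω; simp [hDdef, mul_assoc]
      rw [e5]
      filter_upwards [e1, e3, e4] with ω h1 h3 h4
      simp [h4, h3, h1, e2]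
  have hrem : ∀ᵐ ω ∂P, ∀ t < T, |M ((t : ℤ) + 1 - n) t ω| ≤ 2 * m * (Φ / n) := by
    rw [ae_all_iff]; intro t
    by_cases ht : t < T
    · filter_upwards [hMφ t ht n] with ω h _
      refine h.trans ?_
      gcongr
      exact phiMixing_le_mixingSum_div Z hn
    · exact Filter.Eventually.of_forall fun _ h => absurd h ht
  set R := 2 * m * (Φ / n) * ∑ t ∈ Finset.range T, |w t| with hR
  have hpt : ∀ᵐ ω ∂P, Real.exp (∑ t ∈ Finset.range T, w t * Z ((t : ℤ) + 1) ω) ≤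
      Real.exp R * ∑ i ∈ Finset.range n, b i / A * Real.exp (∑ t ∈ Finset.range T, D i t ω) := by
    filter_upwards [hrem] with ω hω
    have h1 : ∀ t ∈ Finset.range T, w t * Z ((t : ℤ) + 1) ω =
        w t * M ((t : ℤ) + 1 - n) t ω + ∑ i ∈ Finset.range n, b i / A * D i t ω := by
      intro t ht
      have hs := Finset.sum_range_sub' (fun i : ℕ => M ((t : ℤ) + 1 - i) t ω) n
      have : ∀ i ∈ Finset.range n, b i / A * D i t ω =
          w t * (M ((t : ℤ) + 1 - i) t ω - M ((t : ℤ) + 1 - ((i + 1 : ℕ) : ℤ)) t ω) := by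
        intro i _
        have e : (t : ℤ) + 1 - ((i + 1 : ℕ) : ℤ) = t - i := by push_cast; ring
        have := (hbpos i).ne'
        have := hApos.ne'
        simp only [hDdef, e]
        field_simp
      rw [Finset.sum_congr rfl this, ← Finset.mul_sum, hs]
      simp only [Nat.cast_zero, sub_zero, hM0 t (Finset.mem_range.1 ht)]
      ring
    rw [Finset.sum_congr rfl h1, Finset.sum_add_distrib, Real.exp_add, Finset.sum_comm]
    simp only [← Finset.mul_sum]
    have h2 : ∑ t ∈ Finset.range T, w t * M ((t : ℤ) + 1 - n) t ω ≤ R := by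
      rw [hR, Finset.mul_sum]
      refine Finset.sum_le_sum fun t ht => (le_abs_self _).trans ?_
      rw [abs_mul, mul_comm]
      gcongr
      exact hω t (Finset.mem_range.1 ht)
    have h3 := convexOn_exp.map_sum_le (t := Finset.range n) (w := fun i => b i / A)
      (p := fun i => ∑ t ∈ Finset.range T, D i t ω)
      (fun i _ => (div_pos (hbpos i) hApos).le)
      (by rw [← Finset.sum_div]; exact div_self hApos.ne') (fun _ _ => Set.mem_univ _)
    simp only [smul_eq_mul] at h3
    gcongr
  have hint : Integrable (fun ω => Real.exp R * ∑ i ∈ Finset.range n,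
      b i / A * Real.exp (∑ t ∈ Finset.range T, D i t ω)) P :=
    (integrable_finsetSum _ fun i _ => (hAz i).1.const_mul _).const_mul _
  have hmeas : Measurable
      fun ω => Real.exp (∑ t ∈ Finset.range T, w t * Z ((t : ℤ) + 1) ω) := by
    fun_prop
  have hfin : Integrable
      (fun ω => Real.exp (∑ t ∈ Finset.range T, w t * Z ((t : ℤ) + 1) ω)) P := by
    refine hint.mono' hmeas.aestronglyMeasurable ?_
    filter_upwards [hpt] with ω h
    rwa [Real.norm_of_nonneg (Real.exp_pos _).le]
  refine ⟨hfin, (integral_mono_ae hfin hint hpt).trans ?_⟩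
  rw [integral_const_mul, integral_finsetSum _ fun i _ => (hAz i).1.const_mul _,
    add_comm, Real.exp_add]
  refine mul_le_mul_of_nonneg_left ?_ (Real.exp_pos _).le
  have hE : ∀ i ∈ Finset.range n, ∫ ω, b i / A * Real.exp (∑ t ∈ Finset.range T, D i t ω) ∂P ≤
      b i / A * Real.exp ((5 * m * Φ) ^ 2 / 2 * ∑ t ∈ Finset.range T, w t ^ 2) := by
    intro i _
    rw [integral_const_mul]
    have := (div_pos (hbpos i) hApos).le
    refine mul_le_mul_of_nonneg_left ((hAz i).2.trans (Real.exp_le_exp.2 ?_)) this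
    rw [Finset.mul_sum]
    refine Finset.sum_le_sum fun t _ => ?_
    rw [mul_pow, sq_abs]
    have : A ^ 2 ≤ (5 * m * Φ) ^ 2 := by gcongr
    nlinarith [mul_le_mul_of_nonneg_right this (sq_nonneg (w t))]
  refine (Finset.sum_le_sum hE).trans (le_of_eq ?_)
  rw [← Finset.sum_mul, ← Finset.sum_div, div_self hApos.ne', one_mul]

/-! ### Exponential moments of the excess loss -/

/-- Bernstein's moment condition gives an exponential moment: the exponential series is integrated
term by term, and at the rate `θ = 1 / (2c)` the moment bounds sum to a geometric series. -/
theorem integral_exp_abs_le {Ω : Type*} [MeasurableSpace Ω] {μ : Measure Ω}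
    [IsProbabilityMeasure μ] {ξ : Ω → ℝ} (hξ : Measurable ξ) {v c θ : ℝ} (hv : 0 < v) (hc : 0 < c)
    (hθ : θ = 1 / (2 * c)) (hint : ∀ q : ℕ, Integrable (fun ω => |ξ ω| ^ q) μ)
    (h2 : ∫ ω, ξ ω ^ 2 ∂μ ≤ v)
    (hq : ∀ q : ℕ, 3 ≤ q → ∫ ω, |ξ ω| ^ q ∂μ ≤ v * c ^ (q - 2) * (q.factorial : ℝ) / 2) :
    Integrable (fun ω => Real.exp (θ * |ξ ω|)) μ ∧
      ∫ ω, Real.exp (θ * |ξ ω|) ∂μ ≤ 1 + θ * (1 + v) / 2 + v * θ ^ 2 := by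
  have hθ0 : 0 < θ := by rw [hθ]; positivity
  have hθc : θ * c = 1 / 2 := by rw [hθ]; field_simp
  have h1 : ∫ ω, |ξ ω| ∂μ ≤ (1 + v) / 2 := by
    have hi1 : Integrable (fun ω => |ξ ω|) μ := by simpa using hint 1
    have hi2 : Integrable (fun ω => ξ ω ^ 2) μ := by simpa using hint 2
    calc ∫ ω, |ξ ω| ∂μ ≤ ∫ ω, (1 + ξ ω ^ 2) / 2 ∂μ := by
          refine integral_mono hi1 (((integrable_const _).add hi2).div_const 2) fun ω => ?_
          show |ξ ω| ≤ (1 + ξ ω ^ 2) / 2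
          nlinarith [sq_nonneg (|ξ ω| - 1), sq_abs (ξ ω)]
      _ ≤ (1 + v) / 2 := by
          rw [integral_div, integral_add (integrable_const _) hi2]
          simp only [integral_const, probReal_univ, smul_eq_mul, mul_one]
          linarith
  set a : ℕ → ℝ := fun q => match q with
    | 0 => 1
    | 1 => θ * (1 + v) / 2
    | q + 2 => v * θ ^ 2 / 2 * (1 / 2) ^ q with ha
  have hterm : ∀ q : ℕ, θ ^ q / q.factorial * ∫ ω, |ξ ω| ^ q ∂μ ≤ a q := by
    intro q
    match q with
    | 0 => simp [ha]
    | 1 =>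
      simp only [ha, pow_one, Nat.factorial_one, Nat.cast_one, div_one]
      calc θ * ∫ ω, |ξ ω| ∂μ ≤ θ * ((1 + v) / 2) := by gcongr
        _ = _ := by ring
    | 2 =>
      simp only [ha, sq_abs, pow_zero, mul_one, Nat.factorial_two]
      calc θ ^ 2 / ((2 : ℕ) : ℝ) * ∫ ω, ξ ω ^ 2 ∂μ ≤ θ ^ 2 / ((2 : ℕ) : ℝ) * v := by gcongr
        _ = _ := by push_cast; ring
    | q + 3 =>
      have hf : (0 : ℝ) < (q + 3).factorial := by positivity
      have e : θ ^ (q + 3) = θ ^ 2 * θ ^ (q + 1) := by ring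
      have e' : (1 / 2 : ℝ) ^ (q + 1) = θ ^ (q + 1) * c ^ (q + 1) := by rw [← hθc, mul_pow]
      calc θ ^ (q + 3) / (q + 3).factorial * ∫ ω, |ξ ω| ^ (q + 3) ∂μ
          ≤ θ ^ (q + 3) / (q + 3).factorial *
            (v * c ^ (q + 3 - 2) * ((q + 3).factorial : ℝ) / 2) := by
            gcongr
            exact hq _ (by omega)
        _ = v * θ ^ 2 / 2 * (1 / 2) ^ (q + 1) := by
            rw [e', e, show q + 3 - 2 = q + 1 by omega]
            field_simp
  have hsum : HasSum a (1 + θ * (1 + v) / 2 + v * θ ^ 2) := by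
    have hg : HasSum (fun q : ℕ => v * θ ^ 2 / 2 * (1 / 2) ^ q) (v * θ ^ 2) := by
      have h := (hasSum_geometric_of_lt_one (r := (1 / 2 : ℝ)) (by norm_num) (by norm_num)).mul_left
        (v * θ ^ 2 / 2)
      have e : v * θ ^ 2 / 2 * (1 - 1 / 2 : ℝ)⁻¹ = v * θ ^ 2 := by norm_num
      rwa [e] at h
    refine (hasSum_nat_add_iff' 2).1 ?_
    have e : 1 + θ * (1 + v) / 2 + v * θ ^ 2 - ∑ i ∈ Finset.range 2, a i = v * θ ^ 2 := by
      rw [Finset.sum_range_succ, Finset.sum_range_one]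
      simp only [ha]
      ring
    rw [e]
    exact hg
  have ha0 : ∀ q, 0 ≤ a q := fun q =>
    (mul_nonneg (by positivity) (integral_nonneg fun ω => by positivity)).trans (hterm q)
  have hL : ∫⁻ ω, ENNReal.ofReal (Real.exp (θ * |ξ ω|)) ∂μ ≤
      ENNReal.ofReal (1 + θ * (1 + v) / 2 + v * θ ^ 2) := by
    have hexp : ∀ ω, ENNReal.ofReal (Real.exp (θ * |ξ ω|)) =
        ∑' q : ℕ, ENNReal.ofReal (θ ^ q / q.factorial * |ξ ω| ^ q) := by
      intro ω
      have hs := NormedSpace.expSeries_div_hasSum_exp (θ * |ξ ω|)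
      rw [← Real.exp_eq_exp_ℝ] at hs
      rw [← hs.tsum_eq, ENNReal.ofReal_tsum_of_nonneg (fun q => by positivity) hs.summable]
      congr 1
      ext q
      congr 1
      rw [mul_pow]; ring
    simp only [hexp]
    rw [lintegral_tsum fun q => by fun_prop, ← hsum.tsum_eq,
      ENNReal.ofReal_tsum_of_nonneg ha0 hsum.summable]
    refine ENNReal.tsum_le_tsum fun q => ?_
    rw [← ofReal_integral_eq_lintegral_ofReal ((hint q).const_mul _)
      (Filter.Eventually.of_forall fun ω => by positivity), integral_const_mul]
    exact ENNReal.ofReal_le_ofReal (hterm q)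
  have hm : AEStronglyMeasurable (fun ω => Real.exp (θ * |ξ ω|)) μ := by
    apply Measurable.aestronglyMeasurable; fun_prop
  have hi : Integrable (fun ω => Real.exp (θ * |ξ ω|)) μ := by
    refine ⟨hm, ?_⟩
    rw [hasFiniteIntegral_iff_ofReal (Filter.Eventually.of_forall fun ω => (Real.exp_pos _).le)]
    exact hL.trans_lt ENNReal.ofReal_lt_top
  refine ⟨hi, ?_⟩
  rw [← ENNReal.ofReal_le_ofReal_iff (by positivity), ofReal_integral_eq_lintegral_ofReal hi
    (Filter.Eventually.of_forall fun ω => (Real.exp_pos _).le)]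
  exact hL

theorem exp_le_one_add_add_sq_mul_exp_abs (u : ℝ) :
    Real.exp u ≤ 1 + u + u ^ 2 * Real.exp |u| := by
  have h := Complex.norm_exp_sub_sum_le_norm_mul_exp (u : ℂ) 2
  have e : Complex.exp (u : ℂ) - ∑ m ∈ Finset.range 2, (u : ℂ) ^ m / (m.factorial : ℂ) =
      ((Real.exp u - (1 + u) : ℝ) : ℂ) := by
    simp [Finset.sum_range_succ]
  rw [e, Complex.norm_real, Complex.norm_real, Real.norm_eq_abs, Real.norm_eq_abs, sq_abs] at h
  linarith [le_abs_self (Real.exp u - (1 + u))]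

/-- The excess loss `|y - z|² - y²` of predicting `z` when `y` is observed. -/
noncomputable def excessLoss (z : ℂ) (y : ℝ) : ℝ := ‖z‖ ^ 2 - 2 * y * z.re

theorem abs_excessLoss_le {z : ℂ} {B m e x : ℝ} (hz : ‖z‖ ≤ B) (he : |e| ≤ m) :
    |excessLoss z (e + x)| ≤ ‖z‖ * (B + 2 * m + 2 * |x|) := by
  have h1 : |2 * (e + x) * z.re| ≤ 2 * (m + |x|) * ‖z‖ := by
    have hm : 0 ≤ m := (abs_nonneg e).trans he
    rw [abs_mul, abs_mul, abs_two]
    gcongr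
    · exact (abs_add_le _ _).trans (by gcongr)
    · exact Complex.abs_re_le_norm z
  have h2 : ‖z‖ ^ 2 ≤ ‖z‖ * B := by
    rw [sq]; gcongr
  unfold excessLoss
  refine (abs_sub _ _).trans ?_
  rw [abs_of_nonneg (by positivity : (0 : ℝ) ≤ ‖z‖ ^ 2)]
  linarith

/-- The constant in front of the quadratic term of the exponential moment of the excess loss. -/
noncomputable def lossVar (θ K B m : ℝ) : ℝ := 32 / θ ^ 2 * Real.exp (θ * (B + 2 * m) / 2) * K

/-- The exponential moment of the excess loss when only the error `ξ` is random. The quadratic term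
is proportional to `‖z‖²`, as in Bernstein's inequality. -/
theorem integral_exp_excessLoss_le {Ω : Type*} [MeasurableSpace Ω] {μ : Measure Ω}
    [IsProbabilityMeasure μ] {ξ : Ω → ℝ} (hξ : Measurable ξ) (hξi : Integrable ξ μ)
    (hξ0 : ∫ ω, ξ ω ∂μ = 0) {θ K B m l e : ℝ} (hθ : 0 < θ) (hB : 0 < B)
    (hK : Integrable (fun ω => Real.exp (θ * |ξ ω|)) μ)
    (hK' : ∫ ω, Real.exp (θ * |ξ ω|) ∂μ ≤ K) {z : ℂ} (hz : ‖z‖ ≤ B) (he : |e| ≤ m)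
    (hl : |l| ≤ θ / (4 * B)) :
    Integrable (fun ω => Real.exp (l * excessLoss z (e + ξ ω))) μ ∧
      ∫ ω, Real.exp (l * excessLoss z (e + ξ ω)) ∂μ ≤
        1 + l * (‖z‖ ^ 2 - 2 * e * z.re) + l ^ 2 * (lossVar θ K B m * ‖z‖ ^ 2) := by
  have hm : 0 ≤ m := (abs_nonneg e).trans he
  set C : ℝ := 32 / θ ^ 2 * Real.exp (θ * (B + 2 * m) / 2) with hC
  have hpt : ∀ ω, Real.exp (l * excessLoss z (e + ξ ω)) ≤
      1 + l * (‖z‖ ^ 2 - 2 * e * z.re) + (-(2 * l * z.re)) * ξ ω +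
        l ^ 2 * ‖z‖ ^ 2 * C * Real.exp (θ * |ξ ω|) := by
    intro ω
    set x := ξ ω
    set s := B + 2 * m + 2 * |x| with hs
    have hs0 : 0 ≤ s := by positivity
    set u := l * excessLoss z (e + x) with hu
    have hu1 : |u| ≤ |l| * ‖z‖ * s := by
      rw [hu, abs_mul, mul_assoc]
      gcongr
      exact abs_excessLoss_le hz he
    have hu2 : |u| ≤ θ / 4 * s := by
      refine hu1.trans ?_
      gcongr
      calc |l| * ‖z‖ ≤ θ / (4 * B) * B := by gcongr
        _ = θ / 4 := by field_simp
    have hu3 : u ^ 2 ≤ l ^ 2 * ‖z‖ ^ 2 * s ^ 2 := by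
      rw [← sq_abs u, ← sq_abs l, ← mul_pow, ← mul_pow]
      gcongr
    have hs2 : s ^ 2 ≤ 32 / θ ^ 2 * Real.exp (θ / 4 * s) := by
      have := Real.quadratic_le_exp_of_nonneg (x := θ / 4 * s) (by positivity)
      rw [div_mul_eq_mul_div, le_div_iff₀ (by positivity)]
      have h0 : 0 ≤ θ / 4 * s := by positivity
      nlinarith
    have hexp : Real.exp (θ / 4 * s) * Real.exp (θ / 4 * s) =
        Real.exp (θ * (B + 2 * m) / 2) * Real.exp (θ * |x|) := by
      rw [← Real.exp_add, ← Real.exp_add, hs]; congr 1; ring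
    calc Real.exp u ≤ 1 + u + u ^ 2 * Real.exp |u| := exp_le_one_add_add_sq_mul_exp_abs u
      _ ≤ 1 + u + l ^ 2 * ‖z‖ ^ 2 * (32 / θ ^ 2 * Real.exp (θ / 4 * s)) *
          Real.exp (θ / 4 * s) := by
          gcongr
          exact hu3.trans (by gcongr)
      _ = 1 + u + l ^ 2 * ‖z‖ ^ 2 * (32 / θ ^ 2) *
          (Real.exp (θ / 4 * s) * Real.exp (θ / 4 * s)) := by ring
      _ = _ := by rw [hexp, hu, hC, excessLoss]; ring
  have hi1 : Integrable (fun ω => 1 + l * (‖z‖ ^ 2 - 2 * e * z.re) + (-(2 * l * z.re)) * ξ ω) μ :=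
    (integrable_const _).add (hξi.const_mul _)
  have hi2 := hK.const_mul (l ^ 2 * ‖z‖ ^ 2 * C)
  have hi : Integrable (fun ω => Real.exp (l * excessLoss z (e + ξ ω))) μ := by
    refine (hi1.add hi2).mono' ?_ (Filter.Eventually.of_forall fun ω => ?_)
    · apply Measurable.aestronglyMeasurable; unfold excessLoss; fun_prop
    · rw [Real.norm_of_nonneg (Real.exp_pos _).le]
      exact hpt ω
  refine ⟨hi, (integral_mono hi (hi1.add hi2) hpt).trans ?_⟩
  have e1 := integral_add hi1 hi2
  simp only [Pi.add_apply] at e1 ⊢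
  rw [e1, integral_add (integrable_const _) (hξi.const_mul _), integral_const_mul, hξ0,
    integral_const_mul]
  simp only [integral_const, probReal_univ, smul_eq_mul, mul_zero, add_zero, one_mul, lossVar]
  have : l ^ 2 * ‖z‖ ^ 2 * C * ∫ ω, Real.exp (θ * |ξ ω|) ∂μ ≤ l ^ 2 * ‖z‖ ^ 2 * C * K := by
    gcongr
  rw [hC] at this ⊢
  linarith

section Design

variable {ι : Type*} [Fintype ι] [MeasurableSpace ι] [MeasurableSingletonClass ι]

/-- The exponential moment of the excess loss when the sampled position `J` and the error are
random, and the noise matrix is fixed. -/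
theorem lintegral_exp_excessLoss_le {Ω : Type*} [MeasurableSpace Ω] {μ : Measure Ω}
    [IsProbabilityMeasure μ] {ξ : Ω → ℝ} (hξ : Measurable ξ) (hξi : Integrable ξ μ)
    (hξ0 : ∫ ω, ξ ω ∂μ = 0) {θ K B m l : ℝ} (hθ : 0 < θ) (hB : 0 < B)
    (hK : Integrable (fun ω => Real.exp (θ * |ξ ω|)) μ)
    (hK' : ∫ ω, Real.exp (θ * |ξ ω|) ∂μ ≤ K) {J : Ω → ι} (hJ : Measurable J)
    (hJξ : IndepFun J ξ μ) {p : ι → ℝ} (hp : ∀ x, (μ.map J).real {x} = p x)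
    {D : ι → ℂ} (hD : ∀ x, ‖D x‖ ≤ B) {e : ι → ℝ} (he : ∀ x, |e x| ≤ m)
    (hl : |l| ≤ θ / (4 * B)) :
    ∫⁻ ω, ENNReal.ofReal (Real.exp (l * excessLoss (D (J ω)) (e (J ω) + ξ ω))) ∂μ ≤
      ENNReal.ofReal (Real.exp (l * ∑ x, p x * (‖D x‖ ^ 2 - 2 * e x * (D x).re) +
        l ^ 2 * (lossVar θ K B m * ∑ x, p x * ‖D x‖ ^ 2))) := by
  have : IsProbabilityMeasure (μ.map J) := Measure.isProbabilityMeasure_map hJ.aemeasurable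
  have : IsProbabilityMeasure (μ.map ξ) := Measure.isProbabilityMeasure_map hξ.aemeasurable
  set f : ι × ℝ → ENNReal := fun q =>
    ENNReal.ofReal (Real.exp (l * excessLoss (D q.1) (e q.1 + q.2))) with hf
  have hfm : Measurable f := by
    have h1 : Measurable fun q : ι × ℝ => D q.1 :=
      (Measurable.of_discrete (f := D)).comp measurable_fst
    have h2 : Measurable fun q : ι × ℝ => e q.1 :=
      (Measurable.of_discrete (f := e)).comp measurable_fst
    simp only [hf, excessLoss]
    fun_prop
  set g : ι → ℝ := fun x => 1 + l * (‖D x‖ ^ 2 - 2 * e x * (D x).re) +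
    l ^ 2 * (lossVar θ K B m * ‖D x‖ ^ 2) with hg
  have hstep : ∀ x, ∫⁻ ω, f (x, ξ ω) ∂μ ≤ ENNReal.ofReal (g x) ∧ 0 ≤ g x := by
    intro x
    obtain ⟨h1, h2⟩ := integral_exp_excessLoss_le hξ hξi hξ0 hθ hB hK hK' (hD x) (he x) hl
    constructor
    · simp only [hf]
      rw [← ofReal_integral_eq_lintegral_ofReal h1
        (Filter.Eventually.of_forall fun ω => (Real.exp_pos _).le)]
      exact ENNReal.ofReal_le_ofReal h2
    · exact (integral_nonneg fun ω => (Real.exp_pos _).le).trans h2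
  have hp0 : ∀ x, 0 ≤ p x := fun x => by rw [← hp]; exact measureReal_nonneg
  have hp1 : ∑ x, p x = 1 := by
    simp only [← hp]
    rw [sum_measureReal_singleton]
    simp
  calc ∫⁻ ω, f (J ω, ξ ω) ∂μ = ∫⁻ q, f q ∂(μ.map fun ω => (J ω, ξ ω)) :=
        (lintegral_map hfm (hJ.prodMk hξ)).symm
    _ = ∫⁻ x, ∫⁻ y, f (x, y) ∂(μ.map ξ) ∂(μ.map J) := by
        rw [hJξ.map_prod_eq_prod_map_map hJ.aemeasurable hξ.aemeasurable,
          lintegral_prod _ hfm.aemeasurable]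
    _ = ∑ x, (∫⁻ ω, f (x, ξ ω) ∂μ) * (μ.map J) {x} := by
        rw [lintegral_fintype]
        refine Finset.sum_congr rfl fun x _ => ?_
        congr 1
        exact lintegral_map (hfm.comp measurable_prodMk_left) hξ
    _ ≤ ∑ x, ENNReal.ofReal (g x * p x) := by
        refine Finset.sum_le_sum fun x _ => ?_
        rw [ENNReal.ofReal_mul (hstep x).2, ← hp, ofReal_measureReal]
        gcongr
        exact (hstep x).1
    _ = ENNReal.ofReal (∑ x, g x * p x) :=
        (ENNReal.ofReal_sum_of_nonneg fun x _ => mul_nonneg (hstep x).2 (hp0 x)).symm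
    _ ≤ _ := by
        refine ENNReal.ofReal_le_ofReal ?_
        have : ∑ x, g x * p x = (l * ∑ x, p x * (‖D x‖ ^ 2 - 2 * e x * (D x).re) +
            l ^ 2 * (lossVar θ K B m * ∑ x, p x * ‖D x‖ ^ 2)) + 1 := by
          rw [← hp1]
          simp only [Finset.mul_sum, ← Finset.sum_add_distrib, hg]
          exact Finset.sum_congr rfl fun x _ => by ring
        rw [this]
        exact Real.add_one_le_exp _

/-- The exponential moment of the total excess loss of a fixed candidate `D`. The positions and the
errors are integrated first, for a fixed noise; what the noise contributes is the exponential
moment of a linear form in `ε`, which the hypothesis `hε` controls. -/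
theorem lintegral_exp_sum_excessLoss_le {Ω : Type*} [MeasurableSpace Ω] {μ : Measure Ω}
    [IsProbabilityMeasure μ] {n : ℕ} {ξ : Fin n → Ω → ℝ} (hξ : ∀ i, Measurable (ξ i))
    (hξi : ∀ i, Integrable (ξ i) μ) (hξ0 : ∀ i, ∫ ω, ξ i ω ∂μ = 0) {θ K B m l : ℝ} (hθ : 0 < θ)
    (hB : 0 < B) (hK : ∀ i, Integrable (fun ω => Real.exp (θ * |ξ i ω|)) μ)
    (hK' : ∀ i, ∫ ω, Real.exp (θ * |ξ i ω|) ∂μ ≤ K) {J : Fin n → Ω → ι}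
    (hJ : ∀ i, Measurable (J i)) (hJξ : ∀ i, IndepFun (J i) (ξ i) μ)
    (hind : iIndepFun (fun i ω => (J i ω, ξ i ω)) μ)
    {p : ι → ℝ} (hp : ∀ i x, (μ.map (J i)).real {x} = p x) {ε : Ω → ι → ℝ} (hεm : Measurable ε)
    (hindε : IndepFun (fun ω i => (J i ω, ξ i ω)) ε μ) (hεb : ∀ᵐ ω ∂μ, ∀ x, |ε ω x| ≤ m)
    {a b : ℝ} (hε : ∀ w : ι → ℝ, ∫⁻ ω, ENNReal.ofReal (Real.exp (∑ x, w x * ε ω x)) ∂μ ≤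
      ENNReal.ofReal (Real.exp (a * ∑ x, w x ^ 2 + b * ∑ x, |w x|)))
    {D : ι → ℂ} (hD : ∀ x, ‖D x‖ ≤ B) (hl : |l| ≤ θ / (4 * B)) :
    ∫⁻ ω, ENNReal.ofReal (Real.exp (l * ∑ i, excessLoss (D (J i ω)) (ε ω (J i ω) + ξ i ω))) ∂μ ≤
      ENNReal.ofReal (Real.exp (n * (l * ∑ x, p x * ‖D x‖ ^ 2 +
        l ^ 2 * (lossVar θ K B m * ∑ x, p x * ‖D x‖ ^ 2)) +
        (a * ∑ x, (2 * n * l * (p x * (D x).re)) ^ 2 +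
          b * ∑ x, |2 * n * l * (p x * (D x).re)|))) := by
  set W : Ω → Fin n → ι × ℝ := fun ω i => (J i ω, ξ i ω) with hW
  have hWm : Measurable W := measurable_pi_lambda _ fun i => (hJ i).prodMk (hξ i)
  have : IsProbabilityMeasure (μ.map W) := Measure.isProbabilityMeasure_map hWm.aemeasurable
  have : IsProbabilityMeasure (μ.map ε) := Measure.isProbabilityMeasure_map hεm.aemeasurable
  have hDm : Measurable D := Measurable.of_discrete
  obtain ⟨h, hh⟩ : ∃ h : (ι × ℝ) → (ι → ℝ) → ENNReal, ∀ q e, h q e =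
      ENNReal.ofReal (Real.exp (l * excessLoss (D q.1) (e q.1 + q.2))) := ⟨_, fun _ _ => rfl⟩
  have heval : Measurable fun q : ι × (ι → ℝ) => q.2 q.1 :=
    measurable_from_prod_countable_right fun x => measurable_pi_apply x
  have hhm : Measurable fun q : (ι × ℝ) × (ι → ℝ) => h q.1 q.2 := by
    have h1 : Measurable fun q : (ι × ℝ) × (ι → ℝ) => q.2 q.1.1 :=
      heval.comp (measurable_fst.fst.prodMk measurable_snd)
    have h2 : Measurable fun q : (ι × ℝ) × (ι → ℝ) => D q.1.1 := hDm.comp measurable_fst.fst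
    simp only [hh, excessLoss]
    fun_prop
  set F : (Fin n → ι × ℝ) × (ι → ℝ) → ENNReal := fun q => ∏ i, h (q.1 i) q.2 with hF
  have hFm : Measurable F := by
    refine Finset.measurable_fun_prod _ fun i _ => ?_
    have hi : Measurable fun q : (Fin n → ι × ℝ) × (ι → ℝ) => (q.1 i, q.2) := by fun_prop
    exact hhm.comp hi
  have hprod : ∀ ω ω', ENNReal.ofReal (Real.exp
      (l * ∑ i, excessLoss (D (J i ω)) (ε ω' (J i ω) + ξ i ω))) = F (W ω, ε ω') := by
    intro ω ω'
    rw [Finset.mul_sum, Real.exp_sum, ENNReal.ofReal_prod_of_nonneg fun _ _ => (Real.exp_pos _).le]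
    simp only [hF, hW, hh]
  have hinner : ∀ e : ι → ℝ, (∀ x, |e x| ≤ m) → ∫⁻ ω, F (W ω, e) ∂μ ≤
      ENNReal.ofReal (Real.exp (n * (l * ∑ x, p x * (‖D x‖ ^ 2 - 2 * e x * (D x).re) +
        l ^ 2 * (lossVar θ K B m * ∑ x, p x * ‖D x‖ ^ 2)))) := by
    intro e he
    have hhe : Measurable fun q => h q e := hhm.comp measurable_prodMk_right
    have hI := hind.comp (fun _ q => h q e) fun _ => hhe
    have hprodI := lintegral_prod_eq_prod_lintegral_of_indepFun Finset.univ _ hI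
      fun i => hhe.comp ((hJ i).prodMk (hξ i))
    simp only [Function.comp_apply] at hprodI
    simp only [hF, hW]
    rw [hprodI, Real.exp_nat_mul,
      ENNReal.ofReal_pow (Real.exp_pos _).le]
    have hi : ∀ i ∈ Finset.univ, ∫⁻ ω, h (J i ω, ξ i ω) e ∂μ ≤ ENNReal.ofReal (Real.exp
        (l * ∑ x, p x * (‖D x‖ ^ 2 - 2 * e x * (D x).re) +
          l ^ 2 * (lossVar θ K B m * ∑ x, p x * ‖D x‖ ^ 2))) := fun i _ => by
      simp only [hh]
      exact lintegral_exp_excessLoss_le (hξ i) (hξi i) (hξ0 i) hθ hB (hK i) (hK' i) (hJ i)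
        (hJξ i) (hp i) hD he hl
    have hc := Finset.prod_le_pow_card Finset.univ _ _ hi
    rwa [Finset.card_univ, Fintype.card_fin] at hc
  have hrw : ∀ ω, n * (l * ∑ x, p x * (‖D x‖ ^ 2 - 2 * ε ω x * (D x).re) +
        l ^ 2 * (lossVar θ K B m * ∑ x, p x * ‖D x‖ ^ 2)) =
      n * (l * ∑ x, p x * ‖D x‖ ^ 2 + l ^ 2 * (lossVar θ K B m * ∑ x, p x * ‖D x‖ ^ 2)) +
        ∑ x, (-(2 * n * l * (p x * (D x).re))) * ε ω x := by
    intro ω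
    have e1 : ∑ x, p x * (‖D x‖ ^ 2 - 2 * ε ω x * (D x).re) =
        ∑ x, p x * ‖D x‖ ^ 2 - ∑ x, 2 * (p x * (D x).re) * ε ω x := by
      rw [← Finset.sum_sub_distrib]
      exact Finset.sum_congr rfl fun x _ => by ring
    have e2 : ∑ x, (-(2 * n * l * (p x * (D x).re))) * ε ω x =
        -(n * l * ∑ x, 2 * (p x * (D x).re) * ε ω x) := by
      rw [Finset.mul_sum, ← Finset.sum_neg_distrib]
      exact Finset.sum_congr rfl fun x _ => by ring
    rw [e1, e2]; ring
  calc ∫⁻ ω, ENNReal.ofReal (Real.exp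
        (l * ∑ i, excessLoss (D (J i ω)) (ε ω (J i ω) + ξ i ω))) ∂μ
      = ∫⁻ ω, F (W ω, ε ω) ∂μ := by simp only [hprod]
    _ = ∫⁻ q, F q ∂(μ.map fun ω => (W ω, ε ω)) := (lintegral_map hFm (hWm.prodMk hεm)).symm
    _ = ∫⁻ e, ∫⁻ y, F (y, e) ∂(μ.map W) ∂(μ.map ε) := by
        rw [hindε.map_prod_eq_prod_map_map hWm.aemeasurable hεm.aemeasurable,
          lintegral_prod_symm _ hFm.aemeasurable]
    _ = ∫⁻ ω', ∫⁻ ω, F (W ω, ε ω') ∂μ ∂μ := by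
        rw [lintegral_map hFm.lintegral_prod_left' hεm]
        refine lintegral_congr fun ω' => ?_
        exact lintegral_map (hFm.comp measurable_prodMk_right) hWm
    _ ≤ ∫⁻ ω, ENNReal.ofReal (Real.exp (n * (l * ∑ x, p x * ‖D x‖ ^ 2 +
          l ^ 2 * (lossVar θ K B m * ∑ x, p x * ‖D x‖ ^ 2)))) * ENNReal.ofReal (Real.exp
          (∑ x, (-(2 * n * l * (p x * (D x).re))) * ε ω x)) ∂μ := by
        refine lintegral_mono_ae ?_
        filter_upwards [hεb] with ω hω
        refine (hinner _ hω).trans (le_of_eq ?_)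
        rw [hrw, Real.exp_add, ENNReal.ofReal_mul (Real.exp_pos _).le]
    _ ≤ _ := by
        rw [lintegral_const_mul' _ _ ENNReal.ofReal_ne_top, Real.exp_add,
          ENNReal.ofReal_mul (Real.exp_pos _).le]
        gcongr
        have hw := hε fun x => -(2 * n * l * (p x * (D x).re))
        simp only [neg_sq, abs_neg] at hw
        exact hw

end Design

/-! ### The oracle inequality over a finite family -/

section Design

variable {ι : Type*} [Fintype ι]

/-- The squared norm of `D` in `L²(p)`. -/
noncomputable def designNormSq (p : ι → ℝ) (D : ι → ℂ) : ℝ := ∑ x, p x * ‖D x‖ ^ 2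

theorem designNormSq_nonneg {p : ι → ℝ} (hp : ∀ x, 0 ≤ p x) (D : ι → ℂ) :
    0 ≤ designNormSq p D :=
  Finset.sum_nonneg fun x _ => mul_nonneg (hp x) (sq_nonneg _)

theorem sq_norm_sub_sq_norm_le {z z' : ℂ} {B η : ℝ} (hz : ‖z‖ ≤ B) (hz' : ‖z'‖ ≤ B)
    (h : ‖z - z'‖ ≤ η) : ‖z‖ ^ 2 - ‖z'‖ ^ 2 ≤ 2 * B * η := by
  have h1 : ‖z‖ - ‖z'‖ ≤ η := (norm_sub_norm_le z z').trans h
  have h0 : 0 ≤ η := (norm_nonneg _).trans h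
  have := norm_nonneg z
  have := norm_nonneg z'
  calc ‖z‖ ^ 2 - ‖z'‖ ^ 2 = (‖z‖ + ‖z'‖) * (‖z‖ - ‖z'‖) := by ring
    _ ≤ (‖z‖ + ‖z'‖) * η := by gcongr
    _ ≤ 2 * B * η := by gcongr; linarith

theorem excessLoss_sub_le {z z' : ℂ} {B η m e x : ℝ} (hz : ‖z‖ ≤ B) (hz' : ‖z'‖ ≤ B)
    (h : ‖z' - z‖ ≤ η) (he : |e| ≤ m) :
    excessLoss z' (e + x) - excessLoss z (e + x) ≤ (2 * B + 2 * m + 2 * |x|) * η := by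
  have h1 := sq_norm_sub_sq_norm_le hz' hz h
  have h2 : |(e + x) * (z' - z).re| ≤ (m + |x|) * η := by
    have hm : 0 ≤ m := (abs_nonneg e).trans he
    rw [abs_mul]
    gcongr
    · exact (abs_add_le _ _).trans (by gcongr)
    · exact (Complex.abs_re_le_norm _).trans h
  have h3 := neg_abs_le ((e + x) * (z' - z).re)
  rw [Complex.sub_re] at h2 h3
  unfold excessLoss
  linarith

theorem designNormSq_sub_le {p : ι → ℝ} (hp : ∀ x, 0 ≤ p x) (hp1 : ∑ x, p x = 1) {B η : ℝ}
    {D D' : ι → ℂ} (hD : ∀ x, ‖D x‖ ≤ B) (hD' : ∀ x, ‖D' x‖ ≤ B) (h : ∀ x, ‖D x - D' x‖ ≤ η) :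
    designNormSq p D - designNormSq p D' ≤ 2 * B * η := by
  unfold designNormSq
  rw [← Finset.sum_sub_distrib]
  calc ∑ x, (p x * ‖D x‖ ^ 2 - p x * ‖D' x‖ ^ 2) ≤ ∑ x, p x * (2 * B * η) := by
        refine Finset.sum_le_sum fun x _ => ?_
        rw [← mul_sub]
        exact mul_le_mul_of_nonneg_left (sq_norm_sub_sq_norm_le (hD x) (hD' x) (h x)) (hp x)
    _ = _ := by rw [← Finset.sum_mul, hp1, one_mul]

/-- A sampling law with mass at most `q` at each point makes the linear form in the noise small:
its weights satisfy `∑ p² ‖D‖² ≤ q ∑ p ‖D‖²`. -/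
theorem linearForm_exponent_le {p : ι → ℝ} (hp : ∀ x, 0 ≤ p x) (hp1 : ∑ x, p x = 1) {n : ℕ}
    {q cP : ℝ} (hpq : ∀ x, p x ≤ q) (hq : n * q ≤ cP) {a b B l V : ℝ} (ha : 0 ≤ a) (hb : 0 ≤ b)
    {D : ι → ℂ} (hD : ∀ x, ‖D x‖ ≤ B) :
    n * (l * ∑ x, p x * ‖D x‖ ^ 2 + l ^ 2 * (V * ∑ x, p x * ‖D x‖ ^ 2)) +
        (a * ∑ x, (2 * n * l * (p x * (D x).re)) ^ 2 + b * ∑ x, |2 * n * l * (p x * (D x).re)|) ≤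
      n * (l * designNormSq p D + l ^ 2 * ((V + 4 * a * cP) * designNormSq p D)) +
        2 * n * b * B * |l| := by
  have hn : (0 : ℝ) ≤ n := Nat.cast_nonneg n
  have hQ := designNormSq_nonneg hp D
  have h1 : ∑ x, (2 * n * l * (p x * (D x).re)) ^ 2 ≤ 4 * n * l ^ 2 * (cP * designNormSq p D) := by
    calc ∑ x, (2 * n * l * (p x * (D x).re)) ^ 2
        ≤ ∑ x, 4 * n * l ^ 2 * (n * q) * (p x * ‖D x‖ ^ 2) := by
          refine Finset.sum_le_sum fun x _ => ?_
          have e1 : (D x).re ^ 2 ≤ ‖D x‖ ^ 2 := by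
            rw [← sq_abs]; gcongr; exact Complex.abs_re_le_norm _
          have e2 : p x * p x ≤ q * p x := mul_le_mul_of_nonneg_right (hpq x) (hp x)
          have e3 : p x * p x * (D x).re ^ 2 ≤ q * p x * ‖D x‖ ^ 2 :=
            mul_le_mul e2 e1 (sq_nonneg _) ((mul_self_nonneg _).trans e2)
          have e4 : 0 ≤ 4 * (n : ℝ) ^ 2 * l ^ 2 := by positivity
          calc (2 * n * l * (p x * (D x).re)) ^ 2
              = 4 * (n : ℝ) ^ 2 * l ^ 2 * (p x * p x * (D x).re ^ 2) := by ring
            _ ≤ 4 * (n : ℝ) ^ 2 * l ^ 2 * (q * p x * ‖D x‖ ^ 2) :=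
              mul_le_mul_of_nonneg_left e3 e4
            _ = _ := by ring
      _ = 4 * n * l ^ 2 * ((n * q) * designNormSq p D) := by
          rw [← Finset.mul_sum]; unfold designNormSq; ring
      _ ≤ _ := by gcongr
  have h2 : ∑ x, |2 * n * l * (p x * (D x).re)| ≤ 2 * n * |l| * B := by
    calc ∑ x, |2 * n * l * (p x * (D x).re)| ≤ ∑ x, 2 * n * |l| * B * p x := by
          refine Finset.sum_le_sum fun x _ => ?_
          rw [abs_mul, abs_mul, abs_mul, abs_mul, abs_two, abs_of_nonneg hn, abs_of_nonneg (hp x)]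
          have e1 : |(D x).re| ≤ B := (Complex.abs_re_le_norm _).trans (hD x)
          have := hp x
          calc 2 * n * |l| * (p x * |(D x).re|) ≤ 2 * n * |l| * (p x * B) := by gcongr
            _ = _ := by ring
      _ = _ := by rw [← Finset.mul_sum, hp1, mul_one]
  have h3 := mul_le_mul_of_nonneg_left h1 ha
  have h4 := mul_le_mul_of_nonneg_left h2 hb
  change n * (l * designNormSq p D + l ^ 2 * (V * designNormSq p D)) + _ ≤ _
  linarith

/-- Markov's inequality for an exponential moment. -/
theorem measure_ge_le_exp_neg {Ω : Type*} [MeasurableSpace Ω] {μ : Measure Ω} {f : Ω → ℝ}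
    (hf : Measurable f) {r : ℝ}
    (h : ∫⁻ ω, ENNReal.ofReal (Real.exp (f ω)) ∂μ ≤ ENNReal.ofReal (Real.exp r)) (y : ℝ) :
    μ {ω | r + y ≤ f ω} ≤ ENNReal.ofReal (Real.exp (-y)) := by
  have h1 := meas_ge_le_lintegral_div (μ := μ) (f := fun ω => ENNReal.ofReal (Real.exp (f ω)))
    (by fun_prop) (ε := ENNReal.ofReal (Real.exp (r + y)))
    (by simp [Real.exp_pos]) ENNReal.ofReal_ne_top
  have hs : {ω | r + y ≤ f ω} ⊆
      {ω | ENNReal.ofReal (Real.exp (r + y)) ≤ ENNReal.ofReal (Real.exp (f ω))} := fun ω hω =>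
    ENNReal.ofReal_le_ofReal (Real.exp_le_exp.2 hω)
  refine (measure_mono hs).trans (h1.trans ?_)
  rw [show -y = r - (r + y) by ring, Real.exp_sub, ENNReal.ofReal_div_of_pos (Real.exp_pos _)]
  gcongr

variable [MeasurableSpace ι] [MeasurableSingletonClass ι]

/-- The oracle inequality for empirical risk minimization over candidates that are close to a
finite family `N`, when the total excess loss of each candidate satisfies Bernstein's exponential
bound `hmgf`. The event controls the empirical risk from below on the family, from above at the
oracle `D₀`, and the size of the errors, which bounds the cost of replacing a candidate by its
neighbour in the family. -/
theorem exists_event_oracle {Ω : Type*} [MeasurableSpace Ω] {μ : Measure Ω}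
    [IsProbabilityMeasure μ] {n : ℕ} (hn : 1 ≤ n) {ξ : Fin n → Ω → ℝ}
    (hξ : ∀ i, Measurable (ξ i)) {θ K B m : ℝ} (hθ : 0 < θ) (hK1 : 1 ≤ K) (hB : 0 < B)
    (hK : ∀ i, Integrable (fun ω => Real.exp (θ * |ξ i ω|)) μ)
    (hK' : ∀ i, ∫ ω, Real.exp (θ * |ξ i ω|) ∂μ ≤ K) (hind : iIndepFun ξ μ)
    {J : Fin n → Ω → ι} (hJ : ∀ i, Measurable (J i)) {ε : Ω → ι → ℝ} (hεm : Measurable ε)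
    (hεb : ∀ᵐ ω ∂μ, ∀ x, |ε ω x| ≤ m)
    {p : ι → ℝ} (hp : ∀ x, 0 ≤ p x) (hp1 : ∑ x, p x = 1) {C c₀ L l : ℝ} (hl0 : 0 < l)
    (hlL : l ≤ L) (hlC : l * C ≤ 1 / 4)
    (hmgf : ∀ D : ι → ℂ, (∀ x, ‖D x‖ ≤ B) → ∀ l : ℝ, |l| ≤ L →
      ∫⁻ ω, ENNReal.ofReal (Real.exp
        (l * ∑ i, excessLoss (D (J i ω)) (ε ω (J i ω) + ξ i ω))) ∂μ ≤
      ENNReal.ofReal (Real.exp (n * (l * designNormSq p D + l ^ 2 * (C * designNormSq p D)) +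
        c₀ * |l|)))
    {κ : Type*} [Fintype κ] [Nonempty κ] {N : κ → ι → ℂ} (hN : ∀ g x, ‖N g x‖ ≤ B)
    {D₀ : ι → ℂ} (hD₀ : ∀ x, ‖D₀ x‖ ≤ B) {α : ℝ} (hα0 : 0 < α) :
    ∃ E : Set Ω, MeasurableSet E ∧ 1 - α ≤ μ.real E ∧ ∀ ω ∈ E, ∀ D : ι → ℂ, (∀ x, ‖D x‖ ≤ B) →
      (∃ g, ∀ x, ‖D x - N g x‖ ≤ B / n) →
      ∑ i, excessLoss (D (J i ω)) (ε ω (J i ω) + ξ i ω) ≤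
        ∑ i, excessLoss (D₀ (J i ω)) (ε ω (J i ω) + ξ i ω) →
      3 / 4 * (n * designNormSq p D) ≤ 5 / 4 * (n * designNormSq p D₀) +
        (2 * c₀ + 2 * (Real.log (Fintype.card κ) + Real.log (4 / α)) / l + 4 * B ^ 2 + 2 * m * B +
          2 * B / θ * (Real.log K + Real.log (4 / α) / n)) := by
  have hn' : (0 : ℝ) < n := by exact_mod_cast hn
  have hcard : (0 : ℝ) < Fintype.card κ := by exact_mod_cast Fintype.card_pos
  have hcard1 : (1 : ℝ) ≤ Fintype.card κ := by exact_mod_cast Fintype.card_pos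
  set y := Real.log (Fintype.card κ) + Real.log (4 / α) with hy
  set S : (ι → ℂ) → Ω → ℝ := fun D ω =>
    ∑ i, excessLoss (D (J i ω)) (ε ω (J i ω) + ξ i ω) with hS
  have heval : Measurable fun q : ι × (ι → ℝ) => q.2 q.1 :=
    measurable_from_prod_countable_right fun x => measurable_pi_apply x
  have hSm : ∀ D, Measurable (S D) := by
    intro D
    refine Finset.measurable_fun_sum _ fun i _ => ?_
    have h1 : Measurable fun ω => ε ω (J i ω) := heval.comp ((hJ i).prodMk hεm)
    have h2 : Measurable fun ω => D (J i ω) := (Measurable.of_discrete (f := D)).comp (hJ i)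
    exact (h2.norm.pow_const 2).sub
      (((h1.add (hξ i)).const_mul 2).mul (Complex.measurable_re.comp h2))
  set r : ℝ → (ι → ℂ) → ℝ := fun l D =>
    n * (l * designNormSq p D + l ^ 2 * (C * designNormSq p D)) + c₀ * |l| with hr
  have hey : Real.exp (-y) = α / (4 * Fintype.card κ) := by
    rw [hy, Real.exp_neg, Real.exp_add, Real.exp_log hcard, Real.exp_log (by positivity)]
    field_simp
  have hez : Real.exp (-Real.log (4 / α)) = α / 4 := by
    rw [Real.exp_neg, Real.exp_log (by positivity), inv_div]
  -- the events on which one of the required bounds fails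
  set bad₁ : κ → Set Ω := fun g => {ω | r (-l) (N g) + y ≤ -l * S (N g) ω} with hbad₁
  set bad₂ : Set Ω := {ω | r l D₀ + y ≤ l * S D₀ ω} with hbad₂
  set bad₃ : Set Ω :=
    {ω | n * Real.log K + Real.log (4 / α) ≤ ∑ i, θ * |ξ i ω|} with hbad₃
  set bad₄ : Set Ω := {ω | ¬ ∀ x, |ε ω x| ≤ m} with hbad₄
  have m₁ : ∀ g, MeasurableSet (bad₁ g) := fun g =>
    measurableSet_le measurable_const ((hSm _).const_mul _)
  have m₂ : MeasurableSet bad₂ := measurableSet_le measurable_const ((hSm _).const_mul _)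
  have m₃ : MeasurableSet bad₃ :=
    measurableSet_le measurable_const (Finset.measurable_fun_sum _ fun i _ => by fun_prop)
  have m₄ : MeasurableSet bad₄ := by
    have e : bad₄ = (⋂ x, {ω | |ε ω x| ≤ m})ᶜ := by ext ω; simp [hbad₄]
    rw [e]
    exact (MeasurableSet.iInter fun x =>
      measurableSet_le ((measurable_pi_apply x).comp hεm).abs measurable_const).compl
  have b₁ : ∀ g, μ (bad₁ g) ≤ ENNReal.ofReal (α / (4 * Fintype.card κ)) := fun g => by
    rw [← hey]
    exact measure_ge_le_exp_neg ((hSm _).const_mul _)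
      (hmgf _ (hN g) (-l) (by rw [abs_neg, abs_of_pos hl0]; exact hlL)) y
  have b₂ : μ bad₂ ≤ ENNReal.ofReal (α / 4) := by
    refine (measure_ge_le_exp_neg ((hSm _).const_mul _)
      (hmgf _ hD₀ l (by rw [abs_of_pos hl0]; exact hlL)) y).trans ?_
    rw [hey]
    refine ENNReal.ofReal_le_ofReal ?_
    gcongr
    linarith
  have b₃ : μ bad₃ ≤ ENNReal.ofReal (α / 4) := by
    rw [← hez]
    refine measure_ge_le_exp_neg (Finset.measurable_fun_sum _ fun i _ => by fun_prop) ?_ _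
    have hI := hind.comp (fun _ x => ENNReal.ofReal (Real.exp (θ * |x|))) fun _ => by fun_prop
    have hprod := lintegral_prod_eq_prod_lintegral_of_indepFun Finset.univ _ hI
      fun i => by
        have := hξ i
        simp only [Function.comp_def]
        fun_prop
    simp only [Function.comp_apply] at hprod
    have he : ∀ ω, ENNReal.ofReal (Real.exp (∑ i, θ * |ξ i ω|)) =
        ∏ i, ENNReal.ofReal (Real.exp (θ * |ξ i ω|)) := fun ω => by
      rw [Real.exp_sum, ENNReal.ofReal_prod_of_nonneg fun _ _ => (Real.exp_pos _).le]
    have hi : ∀ i ∈ Finset.univ, ∫⁻ ω, ENNReal.ofReal (Real.exp (θ * |ξ i ω|)) ∂μ ≤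
        ENNReal.ofReal K := fun i _ => by
      rw [← ofReal_integral_eq_lintegral_ofReal (hK i)
        (Filter.Eventually.of_forall fun ω => (Real.exp_pos _).le)]
      exact ENNReal.ofReal_le_ofReal (hK' i)
    have hc := Finset.prod_le_pow_card Finset.univ _ _ hi
    rw [Finset.card_univ, Fintype.card_fin] at hc
    rw [lintegral_congr he, hprod, Real.exp_nat_mul, Real.exp_log (by linarith),
      ENNReal.ofReal_pow (by linarith)]
    exact hc
  have b₄ : μ bad₄ = 0 := ae_iff.1 hεb
  set bad := (⋃ g, bad₁ g) ∪ bad₂ ∪ bad₃ ∪ bad₄ with hbad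
  have hbm : MeasurableSet bad := (((MeasurableSet.iUnion m₁).union m₂).union m₃).union m₄
  have hbμ : μ bad ≤ ENNReal.ofReal α := by
    have hU : μ (⋃ g, bad₁ g) ≤ ENNReal.ofReal (α / 4) := by
      refine (measure_iUnion_fintype_le μ bad₁).trans ((Finset.sum_le_sum fun g _ => b₁ g).trans ?_)
      rw [Finset.sum_const, Finset.card_univ, nsmul_eq_mul, ← ENNReal.ofReal_natCast,
        ← ENNReal.ofReal_mul hcard.le]
      refine ENNReal.ofReal_le_ofReal (le_of_eq ?_)
      field_simp
    calc μ bad ≤ μ (⋃ g, bad₁ g) + μ bad₂ + μ bad₃ + μ bad₄ :=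
          (measure_union_le _ _).trans (add_le_add_left ((measure_union_le _ _).trans
            (add_le_add_left (measure_union_le _ _) _)) _)
      _ ≤ ENNReal.ofReal (α / 4) + ENNReal.ofReal (α / 4) + ENNReal.ofReal (α / 4) + 0 := by
          gcongr
          exact b₄.le
      _ = ENNReal.ofReal (α / 4 + α / 4 + α / 4) := by
          rw [add_zero, ENNReal.ofReal_add (by positivity) (by positivity),
            ENNReal.ofReal_add (by positivity) (by positivity)]
      _ ≤ _ := ENNReal.ofReal_le_ofReal (by linarith)
  refine ⟨badᶜ, hbm.compl, ?_, ?_⟩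
  · rw [probReal_compl_eq_one_sub hbm]
    have : μ.real bad ≤ α := ENNReal.toReal_le_of_le_ofReal hα0.le hbμ
    linarith
  intro ω hω D hD hDN hmin
  obtain ⟨g, hg⟩ := hDN
  simp only [hbad, Set.mem_compl_iff, Set.mem_union, Set.mem_iUnion, not_or, not_exists] at hω
  obtain ⟨⟨⟨hω₁, hω₂⟩, hω₃⟩, hω₄⟩ := hω
  have hω₁ := hω₁ g
  simp only [hbad₁, hbad₂, hbad₃, hbad₄, Set.mem_ofPred_eq, not_le, not_not, hr, abs_neg,
    abs_of_pos hl0] at hω₁ hω₂ hω₃ hω₄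
  have hQ0 : 0 ≤ n * designNormSq p D₀ := mul_nonneg hn'.le (designNormSq_nonneg hp _)
  have hQN : 0 ≤ n * designNormSq p (N g) := mul_nonneg hn'.le (designNormSq_nonneg hp _)
  have hlow : 3 / 4 * (n * designNormSq p (N g)) ≤ S (N g) ω + c₀ + y / l := by
    have h1 := mul_le_mul_of_nonneg_right hlC hQN
    have h2 : y = l * (y / l) := by field_simp
    have h3 : l * (3 / 4 * (n * designNormSq p (N g))) ≤ l * (S (N g) ω + c₀ + y / l) := by
      rw [mul_add, mul_add, ← h2]
      nlinarith [mul_le_mul_of_nonneg_left h1 hl0.le]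
    exact le_of_mul_le_mul_left h3 hl0
  have hup : S D₀ ω ≤ 5 / 4 * (n * designNormSq p D₀) + c₀ + y / l := by
    have h1 := mul_le_mul_of_nonneg_right hlC hQ0
    have h2 : y = l * (y / l) := by field_simp
    have h3 : l * S D₀ ω ≤ l * (5 / 4 * (n * designNormSq p D₀) + c₀ + y / l) := by
      rw [mul_add, mul_add, ← h2]
      nlinarith [mul_le_mul_of_nonneg_left h1 hl0.le]
    exact le_of_mul_le_mul_left h3 hl0
  have hpert : S (N g) ω - S D ω ≤ (2 * B + 2 * m) * B + 2 * B / n * ∑ i, |ξ i ω| := by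
    simp only [hS]
    rw [← Finset.sum_sub_distrib]
    calc _ ≤ ∑ i, (2 * B + 2 * m + 2 * |ξ i ω|) * (B / n) :=
          Finset.sum_le_sum fun i _ => excessLoss_sub_le (hD _) (hN g _)
            (by rw [norm_sub_rev]; exact hg _) (hω₄ _)
      _ = _ := by
          rw [← Finset.sum_mul, Finset.sum_add_distrib, ← Finset.mul_sum]
          simp only [Finset.sum_const, Finset.card_univ, Fintype.card_fin, nsmul_eq_mul]
          field_simp
  have hξsum : 2 * B / n * ∑ i, |ξ i ω| ≤ 2 * B / θ * (Real.log K + Real.log (4 / α) / n) := by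
    rw [← Finset.mul_sum] at hω₃
    calc 2 * B / n * ∑ i, |ξ i ω| = 2 * B / n / θ * (θ * ∑ i, |ξ i ω|) := by field_simp
      _ ≤ 2 * B / n / θ * (n * Real.log K + Real.log (4 / α)) := by gcongr
      _ = _ := by field_simp
  have hnorm := designNormSq_sub_le hp hp1 hD (hN g) hg
  have hnorm' : n * designNormSq p D - n * designNormSq p (N g) ≤ 2 * B ^ 2 := by
    rw [← mul_sub]
    calc n * (designNormSq p D - designNormSq p (N g)) ≤ n * (2 * B * (B / n)) := by gcongr
      _ = 2 * B ^ 2 := by field_simp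
  have h2y : 2 * y / l = y / l + y / l := by ring
  rw [h2y]
  have hmin' : S D ω ≤ S D₀ ω := hmin
  nlinarith [sq_nonneg B]

end Design

/-! ### The noise matrix and the approximation of the candidates -/

/-- The exponential moment of a linear form in the noise matrix: the rows are independent, and each
of them is a stretch of the φ-mixing process. -/
theorem lintegral_exp_noise_le {Ω Ω' : Type*} [MeasurableSpace Ω] [MeasurableSpace Ω']
    {μ : Measure Ω} {ν : Measure Ω'} [IsProbabilityMeasure μ] [IsProbabilityMeasure ν] {d T n : ℕ}
    (hn : 1 ≤ n) {ε : Ω → Matrix (Fin d) (Fin T) ℝ} (hεm : Measurable ε)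
    (hind : iIndepFun (fun j ω => ε ω j) μ) (h0 : ∀ j t, ∫ ω, ε ω j t ∂μ = 0) {Z : ℤ → Ω' → ℝ}
    (hZ : RowsFromProcess μ ν ε Z) {m : ℝ} (hm : 0 < m) (hb : ∀ᵐ ω ∂μ, ∀ j t, |ε ω j t| ≤ m)
    (w : Fin d × Fin T → ℝ) :
    ∫⁻ ω, ENNReal.ofReal (Real.exp (∑ x, w x * ε ω x.1 x.2)) ∂μ ≤
      ENNReal.ofReal (Real.exp ((5 * m * mixingSum ν Z n) ^ 2 / 2 * ∑ x, w x ^ 2 +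
        2 * m * (mixingSum ν Z n / n) * ∑ x, |w x|)) := by
  obtain ⟨hZm, hid⟩ := hZ
  set a := (5 * m * mixingSum ν Z n) ^ 2 / 2
  set b := 2 * m * (mixingSum ν Z n / n)
  have hrowm : ∀ j, Measurable fun v : Fin T → ℝ =>
      ENNReal.ofReal (Real.exp (∑ t, w (j, t) * v t)) := fun j => by fun_prop
  have hεj : ∀ j, Measurable fun ω => ε ω j := fun j => (measurable_pi_apply j).comp hεm
  have hrow : ∀ j, ∫⁻ ω, ENNReal.ofReal (Real.exp (∑ t, w (j, t) * ε ω j t)) ∂μ ≤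
      ENNReal.ofReal (Real.exp (a * ∑ t, w (j, t) ^ 2 + b * ∑ t, |w (j, t)|)) := by
    intro j
    have hidt : ∀ t : Fin T, IdentDistrib (fun ω => ε ω j t) (Z ((t : ℤ) + 1)) μ ν := fun t =>
      (hid j).comp (u := fun v : Fin T → ℝ => v t) (measurable_pi_apply t)
    set w' : ℕ → ℝ := fun t => if h : t < T then w (j, ⟨t, h⟩) else 0 with hw'
    have hww : ∀ t : Fin T, w' t = w (j, t) := fun t => by simp [hw']
    obtain ⟨h1, h2⟩ := integral_exp_weighted_sum_le (P := ν) hZm (T := T) hn hm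
      (fun t ht => (hidt ⟨t, ht⟩).ae_snd (p := fun x => |x| ≤ m)
        (measurableSet_le measurable_id.abs measurable_const)
        (by filter_upwards [hb] with ω h using h j ⟨t, ht⟩))
      (fun t ht => ((hidt ⟨t, ht⟩).integral_eq).symm.trans (h0 j ⟨t, ht⟩)) w'
    simp only [Finset.sum_range, hww] at h1 h2
    calc ∫⁻ ω, ENNReal.ofReal (Real.exp (∑ t, w (j, t) * ε ω j t)) ∂μ
        = ∫⁻ ω', ENNReal.ofReal (Real.exp (∑ t : Fin T, w (j, t) * Z ((t : ℤ) + 1) ω')) ∂ν :=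
          ((hid j).comp (hrowm j)).lintegral_eq
      _ ≤ _ := by
          rw [← ofReal_integral_eq_lintegral_ofReal h1
            (Filter.Eventually.of_forall fun ω => (Real.exp_pos _).le)]
          exact ENNReal.ofReal_le_ofReal h2
  have hprod : ∀ ω, ENNReal.ofReal (Real.exp (∑ x : Fin d × Fin T, w x * ε ω x.1 x.2)) =
      ∏ j, ENNReal.ofReal (Real.exp (∑ t, w (j, t) * ε ω j t)) := fun ω => by
    rw [Fintype.sum_prod_type, Real.exp_sum,
      ENNReal.ofReal_prod_of_nonneg fun _ _ => (Real.exp_pos _).le]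
  have hI := lintegral_prod_eq_prod_lintegral_of_indepFun Finset.univ _ (hind.comp _ hrowm)
    fun j => (hrowm j).comp (hεj j)
  simp only [Function.comp_apply] at hI
  rw [lintegral_congr hprod, hI]
  refine (Finset.prod_le_prod' fun j _ => hrow j).trans (le_of_eq ?_)
  rw [← ENNReal.ofReal_prod_of_nonneg fun _ _ => (Real.exp_pos _).le, ← Real.exp_sum,
    Finset.sum_add_distrib, ← Finset.mul_sum, ← Finset.mul_sum, Fintype.sum_prod_type,
    Fintype.sum_prod_type]

theorem norm_le_entrySup {m n E : Type*} [Finite m] [Finite n] [Norm E] (A : Matrix m n E) (i : m)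
    (j : n) : ‖A i j‖ ≤ entrySup A :=
  le_ciSup (f := fun p : m × n => ‖A p.1 p.2‖) (Set.finite_range _).bddAbove (i, j)

theorem entrySup_le {m n E : Type*} [Norm E] {A : Matrix m n E} {c : ℝ} (hc : 0 ≤ c)
    (h : ∀ i j, ‖A i j‖ ≤ c) : entrySup A ≤ c :=
  Real.iSup_le (fun p => h p.1 p.2) hc

theorem frob_toC_single {d T : ℕ} (x : Fin d × Fin T) (M : Matrix (Fin d) (Fin T) ℂ) :
    frob (toC (Matrix.single x.1 x.2 (1 : ℝ))) M = M x.1 x.2 := by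
  have h : toC (Matrix.single x.1 x.2 (1 : ℝ)) = Matrix.single x.1 x.2 (1 : ℂ) := by
    ext i j
    simp only [toC, Matrix.map_apply, Matrix.single_apply]
    split_ifs <;> simp
  rw [frob, h, Matrix.conjTranspose_single, Matrix.trace_single_mul]
  simp

theorem toC_sub {m n : Type*} (A B : Matrix m n ℝ) : toC (A - B) = toC A - toC B := by
  ext i j; simp [toC]

/-- The entries of the product of two factors in `factorSet` are bounded. -/
theorem entrySup_le_of_mem_factorSet {d k τ : ℕ} (hk : 1 ≤ k) {m₀ m : ℝ} (hm₀ : 0 < m₀)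
    (hm : 0 < m) {A : Matrix (Fin d) (Fin τ) ℝ} (hA : A ∈ factorSet d k τ m₀ m) :
    entrySup A ≤ m₀ / m := by
  obtain ⟨U, V, hU, hV, rfl⟩ := hA
  have hk' : (0 : ℝ) < k := by exact_mod_cast hk
  refine entrySup_le (by positivity) fun i j => ?_
  rw [Matrix.mul_apply]
  refine (norm_sum_le _ _).trans ?_
  calc ∑ x, ‖U i x * V x j‖ ≤ ∑ _x : Fin k, m₀ / (k * m) := by
        refine Finset.sum_le_sum fun x _ => ?_
        rw [norm_mul, ← Real.mul_self_sqrt (by positivity : 0 ≤ m₀ / (k * m))]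
        exact mul_le_mul ((norm_le_entrySup U i x).trans hU) ((norm_le_entrySup V x j).trans hV)
          (norm_nonneg _) (Real.sqrt_nonneg _)
    _ = m₀ / m := by
        simp only [Finset.sum_const, Finset.card_univ, Fintype.card_fin, nsmul_eq_mul]
        field_simp

/-- The point number `z` of the regular subdivision of `[-b, b]` with step `b / n`. -/
noncomputable def gridPoint (b : ℝ) {n : ℕ} (z : Fin (2 * n + 1)) : ℝ := b * ((z : ℝ) - n) / n

theorem abs_gridPoint_le {b : ℝ} (hb : 0 ≤ b) {n : ℕ} (hn : 1 ≤ n) (z : Fin (2 * n + 1)) :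
    |gridPoint b z| ≤ b := by
  have hn' : (0 : ℝ) < n := by exact_mod_cast hn
  have hz : ((z : ℕ) : ℝ) ≤ 2 * n := by exact_mod_cast Nat.lt_succ_iff.1 z.2
  have hz0 : (0 : ℝ) ≤ (z : ℕ) := Nat.cast_nonneg _
  rw [gridPoint, abs_div, abs_mul, abs_of_nonneg hb, abs_of_pos hn', div_le_iff₀ hn']
  gcongr
  rw [abs_le]
  constructor <;> linarith

theorem exists_gridPoint {b : ℝ} (hb : 0 < b) {n : ℕ} (hn : 1 ≤ n) {u : ℝ} (hu : |u| ≤ b) :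
    ∃ z : Fin (2 * n + 1), |u - gridPoint b z| ≤ b / n := by
  have hn' : (0 : ℝ) < n := by exact_mod_cast hn
  have h1 := (abs_le.1 hu).1
  have h2 := (abs_le.1 hu).2
  set s := (u + b) * n / b with hs
  have hs0 : 0 ≤ s := div_nonneg (mul_nonneg (by linarith) hn'.le) hb.le
  have hs2 : s ≤ (2 * n : ℕ) := by
    rw [hs, div_le_iff₀ hb]; push_cast; nlinarith
  have hfl : ⌊s⌋₊ ≤ 2 * n := Nat.floor_le_of_le hs2
  refine ⟨⟨⌊s⌋₊, by omega⟩, ?_⟩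
  have h3 := Nat.floor_le hs0
  have h4 := Nat.lt_floor_add_one s
  have e : u - gridPoint b (⟨⌊s⌋₊, by omega⟩ : Fin (2 * n + 1)) = b / n * (s - ⌊s⌋₊) := by
    have hsu : b * s = (u + b) * n := by rw [hs]; field_simp
    rw [gridPoint]
    field_simp
    linarith
  rw [e, abs_mul, abs_of_pos (by positivity : 0 < b / n), abs_of_nonneg (by linarith)]
  calc b / n * (s - ⌊s⌋₊) ≤ b / n * 1 := by gcongr; linarith
    _ = b / n := mul_one _

/-- The products of two factors with entries on a grid approximate `factorSet` uniformly. -/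
theorem exists_grid_approx {d k τ : ℕ} (hk : 1 ≤ k) {m₀ m : ℝ} (hm₀ : 0 < m₀) (hm : 0 < m) {n : ℕ}
    (hn : 1 ≤ n) :
    ∃ N : (Fin d × Fin k → Fin (2 * n + 1)) × (Fin k × Fin τ → Fin (2 * n + 1)) →
      Matrix (Fin d) (Fin τ) ℝ, (∀ g, N g ∈ factorSet d k τ m₀ m) ∧
      ∀ A ∈ factorSet d k τ m₀ m, ∃ g, entrySup (A - N g) ≤ 2 * (m₀ / m) / n := by
  have hk' : (0 : ℝ) < k := by exact_mod_cast hk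
  have hn' : (0 : ℝ) < n := by exact_mod_cast hn
  set b := √(m₀ / (k * m)) with hb
  have hb0 : 0 < b := Real.sqrt_pos.2 (by positivity)
  have hbb : b * b = m₀ / (k * m) := Real.mul_self_sqrt (by positivity)
  set U' : (Fin d × Fin k → Fin (2 * n + 1)) → Matrix (Fin d) (Fin k) ℝ := fun g =>
    Matrix.of fun i x => gridPoint b (g (i, x)) with hU'
  set V' : (Fin k × Fin τ → Fin (2 * n + 1)) → Matrix (Fin k) (Fin τ) ℝ := fun g =>
    Matrix.of fun x j => gridPoint b (g (x, j)) with hV'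
  refine ⟨fun g => U' g.1 * V' g.2, fun g => ⟨U' g.1, V' g.2, ?_, ?_, rfl⟩, ?_⟩
  · exact entrySup_le hb0.le fun i x => abs_gridPoint_le hb0.le hn _
  · exact entrySup_le hb0.le fun x j => abs_gridPoint_le hb0.le hn _
  rintro A ⟨U, V, hU, hV, rfl⟩
  have hU1 : ∀ i x, |U i x| ≤ b := fun i x => (norm_le_entrySup U i x).trans hU
  have hV1 : ∀ x j, |V x j| ≤ b := fun x j => (norm_le_entrySup V x j).trans hV
  choose gU hgU using fun q : Fin d × Fin k => exists_gridPoint hb0 hn (hU1 q.1 q.2)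
  choose gV hgV using fun q : Fin k × Fin τ => exists_gridPoint hb0 hn (hV1 q.1 q.2)
  refine ⟨(gU, gV), entrySup_le (by positivity) fun i j => ?_⟩
  have hterm : ∀ x, ‖U i x * V x j - U' gU i x * V' gV x j‖ ≤ 2 * (m₀ / (k * m)) / n := by
    intro x
    have e1 : |U i x - U' gU i x| ≤ b / n := hgU (i, x)
    have e2 : |V x j - V' gV x j| ≤ b / n := hgV (x, j)
    have e3 : |U' gU i x| ≤ b := abs_gridPoint_le hb0.le hn _
    have e : U i x * V x j - U' gU i x * V' gV x j =
        (U i x - U' gU i x) * V x j + U' gU i x * (V x j - V' gV x j) := by ring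
    rw [e, Real.norm_eq_abs]
    refine (abs_add_le _ _).trans ?_
    rw [abs_mul, abs_mul]
    calc |U i x - U' gU i x| * |V x j| + |U' gU i x| * |V x j - V' gV x j|
        ≤ b / n * b + b * (b / n) := by
          gcongr
          exact hV1 x j
      _ = 2 * (b * b) / n := by ring
      _ = _ := by rw [hbb]
  change ‖(U * V - U' gU * V' gV) i j‖ ≤ _
  rw [Matrix.sub_apply, Matrix.mul_apply, Matrix.mul_apply, ← Finset.sum_sub_distrib]
  refine (norm_sum_le _ _).trans ((Finset.sum_le_sum fun x _ => hterm x).trans (le_of_eq ?_))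
  simp only [Finset.sum_const, Finset.card_univ, Fintype.card_fin, nsmul_eq_mul]
  field_simp

/-- Sampling a matrix of `maskSet` is sampling its position. -/
theorem measurableEmbedding_single {d T : ℕ} :
    MeasurableEmbedding fun x : Fin d × Fin T =>
      (Matrix.single x.1 x.2 (1 : ℝ) : Matrix (Fin d) (Fin T) ℝ) := by
  have : MeasurableSingletonClass (Matrix (Fin d) (Fin T) ℝ) :=
    inferInstanceAs (MeasurableSingletonClass (Fin d → Fin T → ℝ))
  refine ⟨?_, Measurable.of_discrete, fun s _ => (Set.toFinite _).measurableSet⟩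
  rintro ⟨i, j⟩ ⟨i', j'⟩ h
  have h1 := congrFun (congrFun h i) j
  simp only [Matrix.single_apply, and_self, if_true] at h1
  by_contra hne
  rw [if_neg (by rintro ⟨rfl, rfl⟩; exact hne rfl)] at h1
  exact one_ne_zero h1

/-- The logarithm of the cardinality of the grid of factors is of the order of the rate. For
`n = 1` the term `log (4 / α)` is needed, and the number of entries is bounded. -/
theorem log_card_grid_le {d k τ n : ℕ} (hk : 1 ≤ k) (hkd : k ≤ d) (hn : 1 ≤ n)
    (hdn : max d τ ≤ n) {R : ℝ} (hR : Real.log 4 ≤ R) :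
    Real.log (Fintype.card ((Fin d × Fin k → Fin (2 * n + 1)) ×
      (Fin k × Fin τ → Fin (2 * n + 1)))) ≤ 3 * (k * (d + τ) * Real.log n + R) := by
  have hn' : (0 : ℝ) < n := by exact_mod_cast hn
  have hcard : ((Fintype.card ((Fin d × Fin k → Fin (2 * n + 1)) ×
      (Fin k × Fin τ → Fin (2 * n + 1))) : ℕ) : ℝ) = (2 * n + 1 : ℝ) ^ (k * (d + τ)) := by
    simp only [Fintype.card_prod, Fintype.card_fun, Fintype.card_fin]
    rw [← pow_add]
    push_cast
    congr 1
    ring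
  rw [hcard, Real.log_pow]
  push_cast
  have hR0 : 0 ≤ R := (Real.log_nonneg (by norm_num)).trans hR
  rcases hn.eq_or_lt with h1 | h2
  · subst h1
    have hd : (d : ℝ) ≤ 1 := by exact_mod_cast (le_max_left _ _).trans hdn
    have hτ : (τ : ℝ) ≤ 1 := by exact_mod_cast (le_max_right _ _).trans hdn
    have hk1 : (k : ℝ) ≤ 1 := (by exact_mod_cast hkd : (k : ℝ) ≤ d).trans hd
    have h3 : Real.log 3 ≤ Real.log 4 := Real.log_le_log (by norm_num) (by norm_num)
    have h3' : 0 ≤ Real.log 3 := Real.log_nonneg (by norm_num)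
    have hkd : (k : ℝ) * (d + τ) ≤ 1 * 2 := by
      gcongr
      linarith
    simp only [Nat.cast_one, mul_one, Real.log_one, mul_zero, zero_add]
    rw [show (2 + 1 : ℝ) = 3 by norm_num]
    calc (k : ℝ) * (d + τ) * Real.log 3 ≤ 1 * 2 * Real.log 3 := by gcongr
      _ ≤ 3 * R := by linarith
  · have h2' : (2 : ℝ) ≤ n := by exact_mod_cast h2
    have h3 : Real.log (2 * n + 1) ≤ 3 * Real.log n := by
      rw [show (3 : ℝ) * Real.log n = ((3 : ℕ) : ℝ) * Real.log n by norm_num, ← Real.log_pow]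
      refine Real.log_le_log (by positivity) ?_
      nlinarith [mul_le_mul_of_nonneg_left h2' hn'.le, mul_pos hn' hn']
    calc (k : ℝ) * (d + τ) * Real.log (2 * n + 1) ≤ k * (d + τ) * (3 * Real.log n) := by gcongr
      _ ≤ _ := by linarith

/-! ### The sampling model -/

/-- The positions of the sampled entries: measurable functions of the masks, with law the weights
of the single-entry matrices. -/
theorem exists_positions {Ω : Type*} [MeasurableSpace Ω] {μ : Measure Ω}
    [IsProbabilityMeasure μ] {d T n : ℕ}
    (hd : 1 ≤ d) (hT : 1 ≤ T) (hn : 1 ≤ n)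
    {P : Measure (Matrix (Fin d) (Fin T) ℝ)} {X : Fin n → Ω → Matrix (Fin d) (Fin T) ℝ}
    (hX : ∀ i, Measurable (X i)) (hmem : ∀ i ω, X i ω ∈ maskSet d T)
    (hlaw : ∀ i, μ.map (X i) = P) :
    ∃ pos : Matrix (Fin d) (Fin T) ℝ → Fin d × Fin T, Measurable pos ∧
      (∀ i ω, X i ω = Matrix.single (pos (X i ω)).1 (pos (X i ω)).2 1) ∧
      (∀ i, ∀ x : Fin d × Fin T, (μ.map fun ω => pos (X i ω)).real {x} =
        P.real {Matrix.single x.1 x.2 1}) ∧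
      ∀ A, piNormSq P A =
        designNormSq (fun x : Fin d × Fin T => P.real {Matrix.single x.1 x.2 1})
          fun x => A x.1 x.2 := by
  have hemb := measurableEmbedding_single (d := d) (T := T)
  have : Nonempty (Fin d × Fin T) := ⟨(⟨0, hd⟩, ⟨0, hT⟩)⟩
  have hpos := hemb.measurable_invFun
  have hleft := hemb.leftInverse_invFun
  set pos := hemb.invFun with hposdef
  have hXpos : ∀ i ω, X i ω = Matrix.single (pos (X i ω)).1 (pos (X i ω)).2 1 := by
    intro i ω
    obtain ⟨x, hx⟩ := hmem i ω
    have : pos (X i ω) = x := by rw [← hx]; exact hleft x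
    rw [this, ← hx]
  have hP : ∀ i, P = (μ.map fun ω => pos (X i ω)).map
      (fun x : Fin d × Fin T => (Matrix.single x.1 x.2 (1 : ℝ) : Matrix (Fin d) (Fin T) ℝ)) := by
    intro i
    have hm : Measurable fun ω => pos (X i ω) := hpos.comp (hX i)
    rw [Measure.map_map hemb.measurable hm, ← hlaw i]
    congr 1
    exact funext fun ω => hXpos i ω
  have hsing : ∀ i, ∀ x : Fin d × Fin T, (μ.map fun ω => pos (X i ω)).real {x} =
      P.real {Matrix.single x.1 x.2 1} := by
    intro i x
    conv_rhs => rw [hP i, Measure.real, hemb.map_apply]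
    congr 2
    ext y
    exact (hemb.injective.eq_iff (a := y) (b := x)).symm
  refine ⟨pos, hpos, hXpos, hsing, fun A => ?_⟩
  have : IsProbabilityMeasure (μ.map fun ω => pos (X ⟨0, hn⟩ ω)) :=
    Measure.isProbabilityMeasure_map (hpos.comp (hX _)).aemeasurable
  have hI : piNormSq P A = piNormSq ((μ.map fun ω => pos (X ⟨0, hn⟩ ω)).map
      (fun x : Fin d × Fin T => (Matrix.single x.1 x.2 (1 : ℝ) : Matrix (Fin d) (Fin T) ℝ))) A :=
    congrArg (fun Q => piNormSq Q A) (hP ⟨0, hn⟩)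
  rw [hI, piNormSq, hemb.integral_map, integral_fintype Integrable.of_finite]
  simp only [designNormSq, frob_toC_single, hsing, smul_eq_mul]

theorem sq_norm_ofReal_sub (y : ℝ) (z : ℂ) : ‖(y : ℂ) - z‖ ^ 2 = y ^ 2 + excessLoss z y := by
  rw [excessLoss, Complex.sq_norm, Complex.sq_norm, Complex.normSq_apply, Complex.normSq_apply]
  simp
  ring

/-- The empirical risk is, up to a term that does not depend on the candidate, the total excess
loss at the sampled positions. -/
theorem empiricalRisk_eq {d T n : ℕ} {X : Fin n → Matrix (Fin d) (Fin T) ℝ}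
    {J : Fin n → Fin d × Fin T} (hX : ∀ i, X i = Matrix.single (J i).1 (J i).2 1)
    (M A : Matrix (Fin d) (Fin T) ℂ)
    (e : Matrix (Fin d) (Fin T) ℝ) (ξ : Fin n → ℝ) :
    empiricalRisk X (observation X (M + toC e) ξ) A =
      1 / n * (∑ i, (e (J i).1 (J i).2 + ξ i) ^ 2 +
        ∑ i, excessLoss ((A - M) (J i).1 (J i).2) (e (J i).1 (J i).2 + ξ i)) := by
  rw [empiricalRisk, ← Finset.sum_add_distrib]
  congr 1
  refine Finset.sum_congr rfl fun i _ => ?_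
  rw [← sq_norm_ofReal_sub, observation, hX i, frob_toC_single, frob_toC_single]
  congr 2
  simp only [Matrix.add_apply, Matrix.sub_apply, toC, Matrix.map_apply]
  push_cast
  ring

/-- The constant of the rate. Here `θ = 1 / (2 cξ)` is a rate at which the errors have an
exponential moment, bounded by `K`; the matrices `(T - T⁰)Λ` have entries at most `B = 2 m₀`; `C` is
the variance factor of the exponential bound and `l` the parameter at which it is used. -/
noncomputable def rateConst (m₀ vξ cξ mε Φ cP : ℝ) : ℝ :=
  let θ := 1 / (2 * cξ)
  let K := 1 + θ * (1 + vξ) / 2 + vξ * θ ^ 2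
  let B := 2 * m₀
  let C := lossVar θ K B mε + 4 * ((5 * mε * Φ) ^ 2 / 2) * cP
  let l := min (θ / (4 * B)) (1 / (4 * C))
  2 * (2 * (4 * mε * Φ * B) + 8 / l + 4 * B ^ 2 + 2 * mε * B + 2 * B / θ * (Real.log K + 1)) + 2

/-- The bound provided by `exists_event_oracle`, with all remainders expressed in terms of `R`. -/
theorem le_of_oracle_bound {Q Q₀ I n c₀ l B m θ k H Lt R : ℝ} (hn : 1 ≤ n) (hc₀ : 0 ≤ c₀)
    (hl : 0 < l) (hB : 0 < B) (hm : 0 < m) (hθ : 0 < θ) (hk : 0 ≤ k) (hI : 0 ≤ I) (hLt : 1 ≤ Lt)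
    (hLR : Lt ≤ R) (hH : H ≤ 3 * R) (hQ₀ : Q₀ ≤ I + 1 / n)
    (h : 3 / 4 * (n * Q) ≤ 5 / 4 * (n * Q₀) + (2 * c₀ + 2 * (H + Lt) / l + 4 * B ^ 2 + 2 * m * B +
      2 * B / θ * (k + Lt / n))) :
    Q ≤ 3 * I + (2 * (2 * c₀ + 8 / l + 4 * B ^ 2 + 2 * m * B + 2 * B / θ * (k + 1)) + 2) *
      (R / n) := by
  have hn' : 0 < n := by linarith
  have hR1 : 1 ≤ R := hLt.trans hLR
  have hLtn : Lt / n ≤ R := (div_le_self (by linarith) hn).trans hLR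
  set M := 2 * c₀ + 8 / l + 4 * B ^ 2 + 2 * m * B + 2 * B / θ * (k + 1) with hM
  have hM0 : 0 ≤ M := by positivity
  have hrem : 2 * c₀ + 2 * (H + Lt) / l + 4 * B ^ 2 + 2 * m * B + 2 * B / θ * (k + Lt / n) ≤
      M * R := by
    have h1 : 2 * (H + Lt) / l ≤ 8 / l * R := by
      rw [div_mul_eq_mul_div]
      exact div_le_div_of_nonneg_right (by linarith) hl.le
    have h2 : 2 * B / θ * (k + Lt / n) ≤ 2 * B / θ * ((k + 1) * R) :=
      mul_le_mul_of_nonneg_left (by nlinarith) (by positivity)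
    have h3 : 2 * c₀ + 4 * B ^ 2 + 2 * m * B ≤ (2 * c₀ + 4 * B ^ 2 + 2 * m * B) * R :=
      le_mul_of_one_le_right (by positivity) hR1
    rw [hM]
    linarith
  refine le_of_mul_le_mul_left (a := n) ?_ hn'
  have h1 : n * (3 * I + (2 * M + 2) * (R / n)) = 3 * (n * I) + (2 * M + 2) * R := by
    field_simp
  have h2 : n * Q₀ ≤ n * I + 1 := by
    calc n * Q₀ ≤ n * (I + 1 / n) := by gcongr
      _ = n * I + 1 := by field_simp
  have h3 : 0 ≤ n * I := by positivity
  have h4 : 0 ≤ M * R := by positivity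
  rw [h1]
  linarith

end LowRankSeries

theorem theorem1 :
    ∃ c : ℝ → ℝ → ℝ → ℝ → ℝ → ℝ → ℝ → ℝ,
    ∀ (m₀ vξ cξ mε cP : ℝ), 0 < m₀ → 0 < vξ → 0 < cξ → 0 < mε → 0 < cP →
    ∀ (d T τ k n : ℕ), 1 ≤ d → 1 ≤ T → 1 ≤ τ → τ ≤ T → 1 ≤ k → k ≤ min d T →
      1 ≤ n → n ≤ d * T → max d τ ≤ n →
    -- the known matrix `Λ`, the number `m_Λ(τ)` and the unknown matrix `T⁰`
    ∀ (Λ : Matrix (Fin τ) (Fin T) ℂ) (mΛτ : ℝ), 1 ≤ mΛτ →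
      (∀ A : Matrix (Fin d) (Fin τ) ℝ,
        LowRankSeries.entrySup (LowRankSeries.toC A * Λ) ≤ mΛτ * LowRankSeries.entrySup A) →
    ∀ T₀ : Matrix (Fin d) (Fin τ) ℝ, LowRankSeries.entrySup T₀ ≤ m₀ / mΛτ →
    -- the random masks, errors and noise matrix
    ∀ (Ω : Type*) [MeasurableSpace Ω] (μ : MeasureTheory.Measure Ω)
      [MeasureTheory.IsProbabilityMeasure μ]
      (P : MeasureTheory.Measure (Matrix (Fin d) (Fin T) ℝ))
      (X : Fin n → Ω → Matrix (Fin d) (Fin T) ℝ) (ξ : Fin n → Ω → ℝ)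
      (ε : Ω → Matrix (Fin d) (Fin T) ℝ),
      LowRankSeries.SamplingModel μ P X ξ ε →
    -- the process that generates the rows of the noise
    ∀ (Ω' : Type*) [MeasurableSpace Ω'] (ν : MeasureTheory.Measure Ω')
      [MeasureTheory.IsProbabilityMeasure ν] (Z : ℤ → Ω' → ℝ),
      LowRankSeries.RowsFromProcess μ ν ε Z →
    LowRankSeries.NoiseBounds μ ξ ε mε vξ cξ →
    (∀ j t, P.real {Matrix.single j t (1 : ℝ)} ≤ cP / (d * T)) →
    -- the constraint set and the least-squares estimator
    ∀ S : Set (Matrix (Fin d) (Fin τ) ℝ), S ⊆ LowRankSeries.factorSet d k τ m₀ mΛτ →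
    ∀ That : Ω → Matrix (Fin d) (Fin τ) ℝ,
      (∀ ω, That ω ∈ S ∧ IsMinOn
        (fun A => LowRankSeries.empiricalRisk (fun i => X i ω)
          (LowRankSeries.observation (fun i => X i ω)
            (LowRankSeries.toC T₀ * Λ + LowRankSeries.toC (ε ω)) (fun i => ξ i ω))
          (LowRankSeries.toC A * Λ)) S (That ω)) →
    ∀ α : ℝ, 0 < α → α < 1 →
    ∃ E : Set Ω, MeasurableSet E ∧ 1 - α ≤ μ.real E ∧ ∀ ω ∈ E,
      LowRankSeries.piNormSq P (LowRankSeries.toC (That ω) * Λ - LowRankSeries.toC T₀ * Λ) ≤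
        3 * (⨅ A : S, LowRankSeries.piNormSq P
          (LowRankSeries.toC ((A : Matrix (Fin d) (Fin τ) ℝ) - T₀) * Λ)) +
        c m₀ vξ cξ mε (LowRankSeries.entrySup Λ) (LowRankSeries.mixingSum ν Z n) cP *
          (k * (d + τ) * (Real.log n / n) + 1 / n * Real.log (4 / α)) := by
  refine ⟨fun m₀ vξ cξ mε _ Φ cP => LowRankSeries.rateConst m₀ vξ cξ mε Φ cP, ?_⟩
  intro m₀ vξ cξ mε cP hm₀ hvξ hcξ hmε hcP d T τ k n hd hT hτ hτT hk hkdT hn hndT hdτn Λ mΛτ hmΛ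
    hΛ T₀ hT₀ Ω _ μ _ P X ξ ε hmodel Ω' _ ν _ Z hZ hnoise hPbd S hS That hThat α hα0 hα1
  open LowRankSeries in
  have hn' : (0 : ℝ) < n := by exact_mod_cast hn
  have hmΛ0 : 0 < mΛτ := by linarith
  obtain ⟨pos, hposm, hXpos, hlaw, hnorm⟩ := exists_positions hd hT hn hmodel.measurable_X
    hmodel.mem_maskSet hmodel.law_X
  set p : Fin d × Fin T → ℝ := fun x => P.real {Matrix.single x.1 x.2 1} with hp
  set J : Fin n → Ω → Fin d × Fin T := fun i ω => pos (X i ω) with hJ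
  have hJm : ∀ i, Measurable (J i) := fun i => hposm.comp (hmodel.measurable_X i)
  have hp0 : ∀ x, 0 ≤ p x := fun x => measureReal_nonneg
  have hp1 : ∑ x, p x = 1 := by
    have : IsProbabilityMeasure (μ.map (J ⟨0, hn⟩)) :=
      Measure.isProbabilityMeasure_map (hJm _).aemeasurable
    simp only [hp, ← hlaw ⟨0, hn⟩]
    rw [sum_measureReal_singleton]
    simp
  set e : Ω → Fin d × Fin T → ℝ := fun ω x => ε ω x.1 x.2 with he
  have hem : Measurable e := measurable_pi_lambda _ fun x =>
    (measurable_pi_apply x.2).comp ((measurable_pi_apply x.1).comp hmodel.measurable_ε)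
  have heb : ∀ᵐ ω ∂μ, ∀ x, |e ω x| ≤ mε := by
    filter_upwards [hnoise.bound_ε] with ω h x using h x.1 x.2
  -- the constants of `rateConst`
  set Φ := mixingSum ν Z n with hΦ
  have hΦ1 : 1 ≤ Φ := one_le_mixingSum Z n
  set θ := 1 / (2 * cξ) with hθ
  set K := 1 + θ * (1 + vξ) / 2 + vξ * θ ^ 2 with hK
  set B := 2 * m₀ with hB
  set a := (5 * mε * Φ) ^ 2 / 2 with ha
  set C := lossVar θ K B mε + 4 * a * cP with hC
  set l := min (θ / (4 * B)) (1 / (4 * C)) with hl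
  have hθ0 : 0 < θ := by positivity
  have hB0 : 0 < B := by positivity
  have hK1 : 1 ≤ K := by
    have : 0 ≤ θ * (1 + vξ) / 2 + vξ * θ ^ 2 := by positivity
    linarith
  have hC0 : 0 < C := by
    have : 0 < lossVar θ K B mε := by unfold lossVar; positivity
    positivity
  have hl0 : 0 < l := lt_min (by positivity) (by positivity)
  have hlC : l * C ≤ 1 / 4 := by
    calc l * C ≤ 1 / (4 * C) * C := by gcongr; exact min_le_right _ _
      _ = 1 / 4 := by field_simp
  have hmom := fun i => integral_exp_abs_le (hmodel.measurable_ξ i) hvξ hcξ hθ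
    (hnoise.integrable_moments i) (hnoise.second_moment i) (hnoise.higher_moments i)
  have hpairm : Measurable fun q : Matrix (Fin d) (Fin T) ℝ × ℝ => (pos q.1, q.2) :=
    (hposm.comp measurable_fst).prodMk measurable_snd
  have hindJ : iIndepFun (fun i ω => (J i ω, ξ i ω)) μ :=
    hmodel.indep_pairs.comp (fun _ q => (pos q.1, q.2)) fun _ => hpairm
  have hindξ : iIndepFun ξ μ := hmodel.indep_pairs.comp (fun _ q => q.2) fun _ => measurable_snd
  have hJξ : ∀ i, IndepFun (J i) (ξ i) μ := fun i =>
    (hmodel.indep_X_ξ i).comp hposm measurable_id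
  have hinde : IndepFun (fun ω i => (J i ω, ξ i ω)) e μ := by
    refine hmodel.indep_ε.comp
      (φ := fun (q : Fin n → Matrix (Fin d) (Fin T) ℝ × ℝ) i => (pos (q i).1, (q i).2))
      (ψ := fun (q : Matrix (Fin d) (Fin T) ℝ) (x : Fin d × Fin T) => q x.1 x.2) ?_ ?_
    · exact measurable_pi_lambda _ fun i => hpairm.comp (measurable_pi_apply i)
    · exact measurable_pi_lambda _ fun x =>
        (measurable_pi_apply x.2).comp (measurable_pi_apply x.1)
  have hnoiseExp := lintegral_exp_noise_le hn hmodel.measurable_ε hmodel.iid_rows_indep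
    hmodel.centered_ε hZ hmε hnoise.bound_ε
  have hnq : n * (cP / (d * T)) ≤ cP := by
    have h1 : (0 : ℝ) < d * T := by
      have : 0 < d * T := by positivity
      exact_mod_cast this
    have h2 : (n : ℝ) ≤ d * T := by exact_mod_cast hndT
    rw [mul_div_assoc', div_le_iff₀ h1]
    nlinarith
  have hmgf : ∀ D : Fin d × Fin T → ℂ, (∀ x, ‖D x‖ ≤ B) → ∀ l : ℝ, |l| ≤ θ / (4 * B) →
      ∫⁻ ω, ENNReal.ofReal (Real.exp
        (l * ∑ i, excessLoss (D (J i ω)) (e ω (J i ω) + ξ i ω))) ∂μ ≤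
      ENNReal.ofReal (Real.exp (n * (l * designNormSq p D + l ^ 2 * (C * designNormSq p D)) +
        4 * mε * Φ * B * |l|)) := by
    intro D hD l hl
    refine (lintegral_exp_sum_excessLoss_le hmodel.measurable_ξ hmodel.integrable_ξ
      hmodel.centered_ξ hθ0 hB0 (fun i => (hmom i).1) (fun i => (hmom i).2) hJm hJξ hindJ hlaw hem
      hinde heb hnoiseExp hD hl).trans (ENNReal.ofReal_le_ofReal (Real.exp_le_exp.2 ?_))
    refine (linearForm_exponent_le hp0 hp1 (fun x => hPbd x.1 x.2) hnq (by positivity)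
      (by positivity) hD).trans (le_of_eq ?_)
    congr 1
    field_simp
    ring
  -- the candidates are bounded
  have hbound : ∀ A : Matrix (Fin d) (Fin τ) ℝ, entrySup A ≤ m₀ / mΛτ →
      ∀ x : Fin d × Fin T, ‖(toC A * Λ - toC T₀ * Λ) x.1 x.2‖ ≤ B := by
    have h1 : ∀ A : Matrix (Fin d) (Fin τ) ℝ, entrySup A ≤ m₀ / mΛτ →
        ∀ i j, ‖(toC A * Λ) i j‖ ≤ m₀ := fun A hA i j => by
      calc ‖(toC A * Λ) i j‖ ≤ mΛτ * entrySup A := (norm_le_entrySup _ i j).trans (hΛ A)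
        _ ≤ mΛτ * (m₀ / mΛτ) := by gcongr
        _ = m₀ := by field_simp
    intro A hA x
    rw [Matrix.sub_apply]
    refine (norm_sub_le _ _).trans ?_
    have := h1 A hA x.1 x.2
    have := h1 T₀ hT₀ x.1 x.2
    linarith
  have hfac := fun (A : Matrix (Fin d) (Fin τ) ℝ) (hA : A ∈ factorSet d k τ m₀ mΛτ) =>
    hbound A (entrySup_le_of_mem_factorSet hk hm₀ hmΛ0 hA)
  obtain ⟨N, hN, hNapprox⟩ := exists_grid_approx (d := d) (k := k) (τ := τ) hk hm₀ hmΛ0 hn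
  -- an oracle in `S` up to `1 / n`
  have hne : Nonempty Ω := μ.nonempty_of_neZero
  have hSne : Nonempty S := ⟨⟨That hne.some, (hThat _).1⟩⟩
  set inf := ⨅ A : S, piNormSq P (toC ((A : Matrix (Fin d) (Fin τ) ℝ) - T₀) * Λ) with hinf
  obtain ⟨⟨A₀, hA₀S⟩, hA₀⟩ := exists_lt_of_ciInf_lt
    (f := fun A : S => piNormSq P (toC ((A : Matrix (Fin d) (Fin τ) ℝ) - T₀) * Λ))
    (lt_add_of_pos_right inf (one_div_pos.2 hn'))
  have hinf0 : 0 ≤ inf := Real.iInf_nonneg fun A => integral_nonneg fun _ => sq_nonneg _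
  obtain ⟨E, hEm, hEμ, hE⟩ := exists_event_oracle hn hmodel.measurable_ξ hθ0 hK1 hB0
    (fun i => (hmom i).1) (fun i => (hmom i).2) hindξ hJm hem heb hp0 hp1 hl0 (min_le_left _ _) hlC
    hmgf (N := fun g (x : Fin d × Fin T) => (toC (N g) * Λ - toC T₀ * Λ) x.1 x.2)
    (fun g => hfac _ (hN g)) (hfac A₀ (hS hA₀S)) hα0
  refine ⟨E, hEm, hEμ, fun ω hω => ?_⟩
  obtain ⟨hThatS, hmin⟩ := hThat ω
  have hrisk := hmin hA₀S
  simp only [Set.mem_ofPred_eq] at hrisk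
  rw [empiricalRisk_eq (J := fun i => J i ω) (fun i => hXpos i ω),
    empiricalRisk_eq (J := fun i => J i ω) (fun i => hXpos i ω)] at hrisk
  have hmain := hE ω hω (fun x => (toC (That ω) * Λ - toC T₀ * Λ) x.1 x.2) (hfac _ (hS hThatS)) ?_
    (le_of_add_le_add_left (le_of_mul_le_mul_left hrisk (by positivity)))
  swap
  · obtain ⟨g, hg⟩ := hNapprox _ (hS hThatS)
    refine ⟨g, fun x => ?_⟩
    have e1 : (toC (That ω) * Λ - toC T₀ * Λ) x.1 x.2 - (toC (N g) * Λ - toC T₀ * Λ) x.1 x.2 =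
        (toC (That ω - N g) * Λ) x.1 x.2 := by
      rw [toC_sub, Matrix.sub_mul]
      simp only [Matrix.sub_apply]
      ring
    rw [e1]
    calc _ ≤ mΛτ * entrySup (That ω - N g) := (norm_le_entrySup _ _ _).trans (hΛ _)
      _ ≤ mΛτ * (2 * (m₀ / mΛτ) / n) := by gcongr
      _ = B / n := by rw [hB]; field_simp
  rw [toC_sub, Matrix.sub_mul] at hA₀
  rw [← hnorm, ← hnorm] at hmain
  have hlogn : 0 ≤ Real.log n := Real.log_natCast_nonneg n
  have hLt : Real.log 4 ≤ Real.log (4 / α) :=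
    Real.log_le_log (by norm_num) (by rw [le_div_iff₀ hα0]; linarith)
  have hlog4 : 1 ≤ Real.log 4 := by
    rw [Real.le_log_iff_exp_le (by norm_num)]
    linarith [Real.exp_one_lt_d9]
  have hcard := log_card_grid_le hk (hkdT.trans (min_le_left _ _)) hn hdτn hLt
  have hLR : Real.log (4 / α) ≤ k * (d + τ) * Real.log n + Real.log (4 / α) := by
    have : 0 ≤ k * (d + τ) * Real.log n := by positivity
    linarith
  have hfinal := le_of_oracle_bound (by exact_mod_cast hn : (1 : ℝ) ≤ n) (by positivity) hl0 hB0
    hmε hθ0 (Real.log_nonneg hK1) hinf0 (hlog4.trans hLt) hLR hcard hA₀.le hmain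
  have hrate : k * (d + τ) * (Real.log n / n) + 1 / n * Real.log (4 / α) =
      (k * (d + τ) * Real.log n + Real.log (4 / α)) / n := by
    field_simp
  rw [hrate]
  exact hfinal
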